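/- Let $Y$ be a set and let $\mathbb A$ be an infinite family of subsets of $Y$ that is * independent: for all finite disjoint $F,G\subseteq\mathbb A$ with $F\neq\emptyset$, the set $\bigcap F\setminus\bigcup G$ is nonempty; and * dense in $2^Y$: the characteristic functions of the members of $\mathbb A$ are dense in $\{0,1\}^Y$ with the product topology. Let $G(Y,\mathbb A)$ be the bipartite graph whose vertex set is the disjoint union $Y\sqcup\mathbb A$ and in which $i\in Y$ and $x\in\mathbb A$ are adjacent if and only if $i\in x$ (and there are no other edges). For a graph $G$ with vertex set $V$, let $B(G)$ be the universal unital C*-algebra generated by unitaries $u_x$ $(x\in V)$ subject to the relations $u_xu_x^*=1$, $u_x^2=1$, $u_xu_y=u_yu_x$ if $x$ and $y$ are not adjacent, and $u_xu_y=-u_yu_x$ if $x$ and $y$ are adjacent. Then $B=B(G(Y,\mathbb A))$ is AM (approximately matricial), that is, it is a direct limit, with unital connecting maps, of full matrix algebras $M_n(\mathbb C)$, $n\ge 1$; equivalently, it is the closure of the union of an upwards directed family of unital *-subalgebras, each isomorphic to some $M_n(\mathbb C)$. Moreover, $B$ is simple (nonzero, and without nontrivial closed two-sided ideals), nuclear (for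 every C*-algebra $C$ there is only one C*-norm on the algebraic tensor product $B\odot C$), unital, and has a unique trace (exactly one tracial state). -/

import Mathlib

universe u v

/-! ### C⋆-seminorms -/

/-- A C⋆-seminorm on a (possibly non-unital) complex ⋆-algebra: a submultiplicative seminorm
satisfying the C⋆-identity `p (a⋆ a) = p (a) ^ 2`. -/
structure CStarSeminorm (R : Type*) [NonUnitalRing R] [StarRing R] [Module ℂ R] extends
    Seminorm ℂ R where
  mul_le' : ∀ a b : R, toFun (a * b) ≤ toFun a * toFun b
  star_mul_self' : ∀ a : R, toFun (star a * a) = toFun a ^ 2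

namespace CStarSeminorm

variable {R : Type*} [NonUnitalRing R] [StarRing R] [Module ℂ R]

noncomputable instance : CoeFun (CStarSeminorm R) (fun _ => R → ℝ) := ⟨fun p => p.toSeminorm⟩

/-- A C⋆-norm is a C⋆-seminorm that vanishes only at `0`. -/
def IsNorm (p : CStarSeminorm R) : Prop := ∀ a, p a = 0 → a = 0

theorem mul_le (p : CStarSeminorm R) (a b : R) : p (a * b) ≤ p a * p b := p.mul_le' a b

theorem star_mul_self (p : CStarSeminorm R) (a : R) : p (star a * a) = p a ^ 2 :=
  p.star_mul_self' a

theorem le_star (p : CStarSeminorm R) (a : R) : p a ≤ p (star a) := by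
  have h := p.mul_le (star a) a
  rw [p.star_mul_self] at h
  have h0 : 0 ≤ p a := apply_nonneg p.toSeminorm a
  have h1 : 0 ≤ p (star a) := apply_nonneg p.toSeminorm _
  rcases h0.eq_or_lt with h2 | h2
  · rw [← h2]; exact h1
  · nlinarith

theorem star_eq (p : CStarSeminorm R) (a : R) : p (star a) = p a :=
  le_antisymm (by simpa using p.le_star (star a)) (p.le_star a)

end CStarSeminorm

/-! ### The universal C⋆-algebra `B(G)` of a graph -/

/-- The free complex unital ⋆-algebra on self-adjoint generators indexed by `V`: its elements are
the finite complex linear combinations of words in the letters `x : V`. -/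
def WordAlgebra (V : Type*) : Type _ := MonoidAlgebra ℂ (FreeMonoid V)

namespace WordAlgebra

variable {V : Type*}

noncomputable instance : Ring (WordAlgebra V) :=
  inferInstanceAs (Ring (MonoidAlgebra ℂ (FreeMonoid V)))

noncomputable instance : Algebra ℂ (WordAlgebra V) :=
  inferInstanceAs (Algebra ℂ (MonoidAlgebra ℂ (FreeMonoid V)))

/-- The scalar multiple `c • w` of a word `w`. -/
noncomputable def mono (w : FreeMonoid V) (c : ℂ) : WordAlgebra V := MonoidAlgebra.single w c

/-- The generator indexed by `x`. -/
noncomputable def gen (x : V) : WordAlgebra V := mono (FreeMonoid.of x) 1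

theorem mono_mul (w w' : FreeMonoid V) (c c' : ℂ) :
    mono w c * mono w' c' = mono (w * w') (c * c') :=
  MonoidAlgebra.single_mul_single w w' c c'

theorem one_eq_mono : (1 : WordAlgebra V) = mono 1 1 := rfl

theorem smul_mono (c : ℂ) (w : FreeMonoid V) (d : ℂ) : c • mono w d = mono w (c * d) :=
  MonoidAlgebra.smul_single c w d

theorem induction {P : WordAlgebra V → Prop} (a : WordAlgebra V) (h0 : P 0)
    (hadd : ∀ a b, P a → P b → P (a + b)) (hmono : ∀ w c, P (mono w c)) : P a :=
  MonoidAlgebra.induction_linear (motive := P) a h0 hadd hmono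

/-- The conjugate-linear map that reverses words. -/
noncomputable def starHom : WordAlgebra V →+ WordAlgebra V :=
  (Finsupp.liftAddHom fun w : FreeMonoid V =>
    (MonoidAlgebra.singleAddHom (star w)).comp (starAddEquiv (R := ℂ)).toAddMonoidHom).comp
    MonoidAlgebra.coeffAddEquiv.toAddMonoidHom

theorem starHom_mono (w : FreeMonoid V) (c : ℂ) : starHom (mono w c) = mono (star w) (star c) :=
  show _ = _ from Finsupp.liftAddHom_apply_single (N := MonoidAlgebra ℂ (FreeMonoid V))
    (fun w => (MonoidAlgebra.singleAddHom (star w)).comp (starAddEquiv (R := ℂ)).toAddMonoidHom) w c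

noncomputable instance : StarRing (WordAlgebra V) where
  star := starHom
  star_involutive a := by
    induction a using induction with
    | h0 => simp
    | hadd a b ha hb => simp [ha, hb]
    | hmono w c => simp [starHom_mono]
  star_mul a b := by
    induction a using induction with
    | h0 => simp
    | hadd a b ha hb => simp [add_mul, mul_add, ha, hb]
    | hmono w c =>
      induction b using induction with
      | h0 => simp
      | hadd a b ha hb => simp [add_mul, mul_add, ha, hb]
      | hmono w' c' => simp [starHom_mono, mono_mul, mul_comm]
  star_add a b := map_add starHom a b

theorem star_mono (w : FreeMonoid V) (c : ℂ) : star (mono w c) = mono (star w) (star c) :=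
  starHom_mono w c

theorem star_gen (x : V) : star (gen x) = gen x := by
  rw [gen, star_mono]; simp

instance : StarModule ℂ (WordAlgebra V) where
  star_smul c a := by
    induction a using induction with
    | h0 => simp
    | hadd a b ha hb => simp [smul_add, ha, hb]
    | hmono w d => simp [star_mono, smul_mono]

end WordAlgebra

open WordAlgebra in
/-- A C⋆-seminorm on the free ⋆-algebra is admissible for `G` if it annihilates the defining
relations of `B(G)`: every generator is a self-adjoint unitary, generators at non-adjacent
vertices commute, and generators at adjacent vertices anticommute. -/
structure SimpleGraph.IsAdmissible {V : Type*} (G : SimpleGraph V)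
    (p : CStarSeminorm (WordAlgebra V)) : Prop where
  mul_star : ∀ x, p (gen x * star (gen x) - 1) = 0
  sq : ∀ x, p (gen x ^ 2 - 1) = 0
  comm : ∀ x y, ¬ G.Adj x y → p (gen x * gen y - gen y * gen x) = 0
  anticomm : ∀ x y, G.Adj x y → p (gen x * gen y + gen y * gen x) = 0

/-- The free ⋆-algebra on the vertices of `G`, to be equipped with the largest admissible
C⋆-seminorm. -/
def SimpleGraph.PreB {V : Type*} (_G : SimpleGraph V) : Type _ := WordAlgebra V

namespace SimpleGraph.PreB

open WordAlgebra

variable {V : Type*} (G : SimpleGraph V)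

noncomputable instance : Ring G.PreB := inferInstanceAs (Ring (WordAlgebra V))
noncomputable instance : Algebra ℂ G.PreB := inferInstanceAs (Algebra ℂ (WordAlgebra V))
noncomputable instance : StarRing G.PreB := inferInstanceAs (StarRing (WordAlgebra V))
instance : StarModule ℂ G.PreB := inferInstanceAs (StarModule ℂ (WordAlgebra V))

/-- The generator at the vertex `x`. -/
noncomputable def gen (x : V) : G.PreB := WordAlgebra.gen x

/-- The admissible C⋆-seminorms. -/
abbrev Adm : Type _ := {p : CStarSeminorm (WordAlgebra V) // G.IsAdmissible p}

/-- The largest admissible C⋆-seminorm (as a function). -/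
noncomputable def maxSeminorm (a : WordAlgebra V) : ℝ := ⨆ p : Adm G, p.1 a

noncomputable instance : Nonempty (Adm G) := by
  refine ⟨⟨⟨0, ?_, ?_⟩, ?_, ?_, ?_, ?_⟩⟩
  · intro a b; show (0 : ℝ) ≤ 0 * 0; simp
  · intro a; show (0 : ℝ) = 0 ^ 2; simp
  all_goals intros; rfl

variable {G}

theorem adm_one_le (p : Adm G) : p.1 1 ≤ 1 := by
  have h := p.1.star_mul_self 1
  simp only [star_one, mul_one] at h
  have h0 : 0 ≤ p.1 1 := apply_nonneg p.1.toSeminorm _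
  nlinarith

theorem adm_gen_le (p : Adm G) (x : V) : p.1 (WordAlgebra.gen x) ≤ 1 := by
  have h := p.1.star_mul_self (WordAlgebra.gen x)
  rw [star_gen] at h
  have h1 : p.1 (WordAlgebra.gen x ^ 2) ≤ p.1 (WordAlgebra.gen x ^ 2 - 1) + p.1 1 := by
    have := map_add_le_add p.1.toSeminorm (WordAlgebra.gen x ^ 2 - 1) 1
    rwa [sub_add_cancel] at this
  rw [p.2.sq, pow_two] at h1
  have h2 := adm_one_le p
  have h0 : 0 ≤ p.1 (WordAlgebra.gen x) := apply_nonneg p.1.toSeminorm _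
  nlinarith

theorem adm_mono_le (p : Adm G) (w : FreeMonoid V) (c : ℂ) : p.1 (mono w c) ≤ ‖c‖ := by
  have key : p.1 (mono w 1) ≤ 1 := by
    induction w using FreeMonoid.inductionOn' with
    | one => rw [← one_eq_mono]; exact adm_one_le p
    | of_mul x w ih =>
      have : (mono (FreeMonoid.of x * w) 1 : WordAlgebra V) = WordAlgebra.gen x * mono w 1 := by
        rw [WordAlgebra.gen, mono_mul, mul_one]
      rw [this]
      refine (p.1.mul_le _ _).trans ?_
      exact mul_le_one₀ (adm_gen_le p x) (apply_nonneg p.1.toSeminorm _) ih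
  have : (mono w c : WordAlgebra V) = c • mono w 1 := by rw [smul_mono, mul_one]
  rw [this, map_smul_eq_mul p.1.toSeminorm]
  exact mul_le_of_le_one_right (norm_nonneg _) key

theorem bddAbove (a : WordAlgebra V) : BddAbove (Set.range fun p : Adm G => p.1 a) := by
  induction a using WordAlgebra.induction with
  | h0 => exact ⟨0, by rintro _ ⟨p, rfl⟩; simp⟩
  | hadd a b ha hb =>
    obtain ⟨A, hA⟩ := ha
    obtain ⟨B, hB⟩ := hb
    refine ⟨A + B, ?_⟩
    rintro _ ⟨p, rfl⟩
    exact (map_add_le_add p.1.toSeminorm a b).trans (add_le_add (hA ⟨p, rfl⟩) (hB ⟨p, rfl⟩))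
  | hmono w c => exact ⟨‖c‖, by rintro _ ⟨p, rfl⟩; exact adm_mono_le p w c⟩

theorem le_max (p : Adm G) (a : WordAlgebra V) : p.1 a ≤ maxSeminorm G a := le_ciSup (bddAbove a) p

theorem max_nonneg (a : WordAlgebra V) : 0 ≤ maxSeminorm G a :=
  (apply_nonneg (Classical.arbitrary (Adm G)).1.toSeminorm a).trans (le_max _ a)

theorem max_eq_zero {a : WordAlgebra V} (h : ∀ p : Adm G, p.1 a = 0) : maxSeminorm G a = 0 := by
  simp [maxSeminorm, h]

theorem max_mul_le (a b : WordAlgebra V) :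
    maxSeminorm G (a * b) ≤ maxSeminorm G a * maxSeminorm G b :=
  ciSup_le fun p => (p.1.mul_le a b).trans
    (mul_le_mul (le_max p a) (le_max p b) (apply_nonneg p.1.toSeminorm _) (max_nonneg a))

theorem max_sq_le (a : WordAlgebra V) :
    maxSeminorm G a * maxSeminorm G a ≤ maxSeminorm G (star a * a) := by
  have h0 : 0 ≤ maxSeminorm G (star a * a) := max_nonneg _
  have h : maxSeminorm G a ≤ √(maxSeminorm G (star a * a)) := ciSup_le fun p =>
    Real.le_sqrt_of_sq_le ((p.1.star_mul_self a).symm.le.trans (le_max p _))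
  calc maxSeminorm G a * maxSeminorm G a ≤ _ := mul_self_le_mul_self (max_nonneg a) h
    _ = _ := Real.mul_self_sqrt h0

theorem max_star (a : WordAlgebra V) : maxSeminorm G (star a) = maxSeminorm G a := by
  simp only [maxSeminorm, CStarSeminorm.star_eq]

theorem max_smul (c : ℂ) (a : WordAlgebra V) :
    maxSeminorm G (c • a) = ‖c‖ * maxSeminorm G a := by
  simp only [maxSeminorm]
  rw [Real.mul_iSup_of_nonneg (norm_nonneg c)]
  exact iSup_congr fun p => map_smul_eq_mul p.1.toSeminorm c a

/-- The norm of `a` is the supremum of `p a` over all admissible C⋆-seminorms `p`. -/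
noncomputable instance : SeminormedRing G.PreB where
  __ := (inferInstance : Ring G.PreB)
  __ := (AddGroupSeminorm.toSeminormedAddCommGroup
    { toFun := maxSeminorm G
      map_zero' := max_eq_zero fun p => map_zero p.1.toSeminorm
      add_le' := fun a b => ciSup_le fun p => (map_add_le_add p.1.toSeminorm a b).trans
        (add_le_add (le_max p a) (le_max p b))
      neg' := fun a => by
        simp only [maxSeminorm]
        exact iSup_congr fun p => map_neg_eq_map p.1.toSeminorm a } :
      SeminormedAddCommGroup G.PreB)
  norm_mul_le a b := max_mul_le a b

theorem norm_def (a : G.PreB) : ‖a‖ = maxSeminorm G a := rfl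

noncomputable instance : NormedAlgebra ℂ G.PreB where
  norm_smul_le c a := (max_smul c a).le

instance : NormedStarGroup G.PreB where
  norm_star_le a := (max_star (G := G) a).le

end SimpleGraph.PreB

/-- The universal unital C⋆-algebra `B(G)` generated by self-adjoint unitaries `u_x`, for `x : V`,
such that `u_x` and `u_y` anticommute if `x` and `y` are adjacent and commute otherwise: the
(Hausdorff) completion of the free ⋆-algebra in its largest admissible C⋆-seminorm. -/
def SimpleGraph.B {V : Type*} (G : SimpleGraph V) : Type _ := UniformSpace.Completion G.PreB

namespace SimpleGraph.B

open UniformSpace WordAlgebra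

variable {V : Type*} (G : SimpleGraph V)

noncomputable instance : NormedRing G.B := inferInstanceAs (NormedRing (Completion G.PreB))

instance : CompleteSpace G.B := inferInstanceAs (CompleteSpace (Completion G.PreB))

/-- The canonical map into the completion. -/
noncomputable def coe (a : G.PreB) : G.B := (a : Completion G.PreB)

variable {G}

theorem coe_add (a b : G.PreB) : coe G (a + b) = coe G a + coe G b := Completion.coe_add a b
theorem coe_sub (a b : G.PreB) : coe G (a - b) = coe G a - coe G b := Completion.coe_sub a b
theorem coe_mul (a b : G.PreB) : coe G (a * b) = coe G a * coe G b := Completion.coe_mul a b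
theorem coe_one : coe G 1 = 1 := Completion.coe_one G.PreB
theorem norm_coe (a : G.PreB) : ‖coe G a‖ = ‖a‖ := Completion.norm_coe a
theorem continuous_coe : Continuous (coe G) := Completion.continuous_coe G.PreB

theorem induction {P : G.B → Prop} (hP : IsClosed {a | P a}) (h : ∀ a, P (coe G a)) (a : G.B) :
    P a :=
  Completion.induction_on (p := P) a hP h

theorem induction₂ {P : G.B → G.B → Prop} (hP : IsClosed {a : G.B × G.B | P a.1 a.2})
    (h : ∀ a b, P (coe G a) (coe G b)) (a b : G.B) : P a b :=
  Completion.induction_on₂ (p := P) a b hP h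

noncomputable instance : NormedAlgebra ℂ G.B where
  __ := (inferInstanceAs (Algebra ℂ (Completion G.PreB)) : Algebra ℂ G.B)
  norm_smul_le c a := (norm_smul_le (β := Completion G.PreB) c a :)

theorem coe_smul (c : ℂ) (a : G.PreB) : coe G (c • a) = c • coe G a := Completion.coe_smul c a

theorem isometry_star_pre : Isometry (star : G.PreB → G.PreB) :=
  AddMonoidHomClass.isometry_of_norm (starAddEquiv (R := G.PreB)) norm_star

/-- The extension of the involution to the completion by continuity. -/
noncomputable instance : Star G.B where
  star := Completion.map (star : G.PreB → G.PreB)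

theorem star_coe (a : G.PreB) : star (coe G a) = coe G (star a) :=
  Completion.map_coe isometry_star_pre.uniformContinuous a

theorem continuous_star : Continuous (star : G.B → G.B) := Completion.continuous_map

noncomputable instance : StarRing G.B where
  star_involutive a := by
    refine induction (P := fun a => star (star a) = a) ?_ (fun a => ?_) a
    · exact isClosed_eq (continuous_star.comp continuous_star) continuous_id
    · rw [star_coe, star_coe, star_star]
  star_mul a b := by
    refine induction₂ (P := fun a b => star (a * b) = star b * star a) ?_ (fun a b => ?_) a b
    · exact isClosed_eq (continuous_star.comp continuous_mul)
        ((continuous_star.comp continuous_snd).mul (continuous_star.comp continuous_fst))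
    · rw [← coe_mul, star_coe, star_coe, star_coe, ← coe_mul, star_mul]
  star_add a b := by
    refine induction₂ (P := fun a b => star (a + b) = star a + star b) ?_ (fun a b => ?_) a b
    · exact isClosed_eq (continuous_star.comp continuous_add)
        ((continuous_star.comp continuous_fst).add (continuous_star.comp continuous_snd))
    · rw [← coe_add, star_coe, star_coe, star_coe, ← coe_add, star_add]

instance : StarModule ℂ G.B where
  star_smul c a := by
    refine induction (P := fun a => star (c • a) = star c • star a) ?_ (fun a => ?_) a
    · exact isClosed_eq (continuous_star.comp (continuous_const_smul c))
        (continuous_star.const_smul (star c))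
    · rw [← coe_smul, star_coe, star_coe, star_smul, coe_smul]

instance : CStarRing G.B where
  norm_mul_self_le a := by
    refine induction (P := fun a => ‖a‖ * ‖a‖ ≤ ‖star a * a‖) ?_ (fun a => ?_) a
    · exact isClosed_le (continuous_norm.mul continuous_norm)
        (continuous_norm.comp (continuous_star.mul continuous_id))
    · rw [star_coe, ← coe_mul, norm_coe, norm_coe]
      exact PreB.max_sq_le a

noncomputable instance : CStarAlgebra G.B where

variable (G)

/-- The canonical generator `u_x` of `B(G)`. -/
noncomputable def u (x : V) : G.B := coe G (PreB.gen G x)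

end SimpleGraph.B

/-- A family `w` of elements of a unital C⋆-algebra satisfies the defining relations of `B(G)`. -/
structure SimpleGraph.IsRepresentation {V : Type*} (G : SimpleGraph V) {A : Type*}
    [CStarAlgebra A] (w : V → A) : Prop where
  mul_star : ∀ x, w x * star (w x) = 1
  sq : ∀ x, w x ^ 2 = 1
  comm : ∀ x y, ¬ G.Adj x y → w x * w y = w y * w x
  anticomm : ∀ x y, G.Adj x y → w x * w y = -(w y * w x)

namespace SimpleGraph.B

open UniformSpace WordAlgebra

variable {V : Type*} (G : SimpleGraph V)

/-- The generators of `B(G)` satisfy the defining relations. -/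
theorem isRepresentation_u : G.IsRepresentation (u G) := by
  have key : ∀ a b : G.PreB, (∀ p : PreB.Adm G, p.1 (a - b : WordAlgebra V) = 0) →
      coe G a = coe G b := by
    intro a b h
    rw [← sub_eq_zero, ← norm_eq_zero, ← coe_sub, norm_coe]
    exact PreB.max_eq_zero h
  refine ⟨fun x => ?_, fun x => ?_, fun x y h => ?_, fun x y h => ?_⟩
  · rw [u, star_coe, ← coe_mul, ← coe_one]
    exact key _ _ fun p => p.2.mul_star x
  · rw [u, pow_two, ← coe_mul, ← coe_one]
    exact key _ _ fun p => by rw [← p.2.sq x, pow_two]; rfl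
  · rw [u, u, ← coe_mul, ← coe_mul]
    exact key _ _ fun p => p.2.comm x y h
  · rw [u, u, ← coe_mul, ← coe_mul, eq_neg_iff_add_eq_zero, ← coe_add, ← norm_eq_zero, norm_coe]
    exact PreB.max_eq_zero fun p => p.2.anticomm x y h

/-- The universal property of `B(G)`: every family that satisfies the defining relations in a
unital C⋆-algebra is the image of the generators under a unique unital ⋆-homomorphism. -/
theorem existsUnique_lift {A : Type*} [CStarAlgebra A] {w : V → A} (hw : G.IsRepresentation w) :
    ∃! π : G.B →⋆ₐ[ℂ] A, ∀ x, π (u G x) = w x := by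
  have hsa : ∀ x, star (w x) = w x := fun x => by
    have h1 := hw.mul_star x
    have h2 := hw.sq x
    calc star (w x) = w x ^ 2 * star (w x) := by rw [h2, one_mul]
      _ = w x := by rw [pow_two, mul_assoc, h1, mul_one]
  let φ : WordAlgebra V →ₐ[ℂ] A := MonoidAlgebra.lift ℂ A (FreeMonoid V) (FreeMonoid.lift w)
  have φ_mono : ∀ v c, φ (mono v c) = c • FreeMonoid.lift w v := fun v c =>
    MonoidAlgebra.lift_single _ v c
  have φ_gen : ∀ x, φ (WordAlgebra.gen x) = w x := fun x => by
    rw [WordAlgebra.gen, φ_mono, one_smul, FreeMonoid.lift_eval_of]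
  have lift_star : ∀ v : FreeMonoid V, FreeMonoid.lift w (star v) = star (FreeMonoid.lift w v) := by
    intro v
    induction v using FreeMonoid.inductionOn' with
    | one => simp
    | of_mul x v ih => simp [ih, hsa]
  have φ_star : ∀ a, φ (star a) = star (φ a) := by
    intro a
    induction a using WordAlgebra.induction with
    | h0 => simp
    | hadd a b ha hb => simp only [star_add, map_add, ha, hb]
    | hmono v c => rw [star_mono, φ_mono, φ_mono, star_smul, lift_star]
  let p : CStarSeminorm (WordAlgebra V) :=
    { toSeminorm := (normSeminorm ℂ A).comp φ.toLinearMap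
      mul_le' := fun a b => by
        change ‖φ (a * b)‖ ≤ ‖φ a‖ * ‖φ b‖
        rw [map_mul]; exact norm_mul_le _ _
      star_mul_self' := fun a => by
        change ‖φ (star a * a)‖ = ‖φ a‖ ^ 2
        rw [map_mul, φ_star, CStarRing.norm_star_mul_self, pow_two] }
  have hp : ∀ a, p a = ‖φ a‖ := fun a => rfl
  have hadm : G.IsAdmissible p := by
    refine ⟨fun x => ?_, fun x => ?_, fun x y h => ?_, fun x y h => ?_⟩
    · rw [hp, map_sub, map_mul, φ_star, φ_gen, map_one, hw.mul_star, sub_self, norm_zero]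
    · rw [hp, map_sub, map_pow, φ_gen, map_one, hw.sq, sub_self, norm_zero]
    · rw [hp, map_sub, map_mul, map_mul, φ_gen, φ_gen, hw.comm x y h, sub_self, norm_zero]
    · rw [hp, map_add, map_mul, map_mul, φ_gen, φ_gen, hw.anticomm x y h, neg_add_cancel,
        norm_zero]
  let ψ : G.PreB →+* A := φ.toRingHom
  have ψ_le : ∀ a, ‖ψ a‖ ≤ ‖a‖ := fun a => PreB.le_max ⟨p, hadm⟩ a
  have ψ_cont : Continuous ψ :=
    AddMonoidHomClass.continuous_of_bound ψ 1 fun a => by rw [one_mul]; exact ψ_le a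
  let Ψ : G.B →+* A := Completion.extensionHom ψ ψ_cont
  have Ψ_coe : ∀ a, Ψ (coe G a) = ψ a := fun a => Completion.extensionHom_coe ψ ψ_cont a
  have Ψ_cont : Continuous Ψ := Completion.continuous_extension
  let π : G.B →⋆ₐ[ℂ] A :=
    { Ψ with
      commutes' := fun c => by
        change Ψ (algebraMap ℂ G.B c) = algebraMap ℂ A c
        rw [Algebra.algebraMap_eq_smul_one, ← coe_one, ← coe_smul, Ψ_coe,
          Algebra.algebraMap_eq_smul_one]
        change φ (c • 1) = c • 1
        rw [map_smul, map_one]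
      map_star' := fun a => by
        change Ψ (star a) = star (Ψ a)
        refine induction (P := fun a => Ψ (star a) = star (Ψ a)) ?_ (fun a => ?_) a
        · exact isClosed_eq (Ψ_cont.comp continuous_star) Ψ_cont.star
        · rw [star_coe, Ψ_coe, Ψ_coe]; exact φ_star a }
  refine ⟨π, fun x => (Ψ_coe _).trans (φ_gen x), fun π' hπ' => ?_⟩
  have cont' : Continuous π' :=
    AddMonoidHomClass.continuous_of_bound π' 1 fun a => by
      rw [one_mul]; exact NonUnitalStarAlgHom.norm_apply_le π' a
  have eq_mono : ∀ (v : FreeMonoid V) (c : ℂ),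
      π' (coe G (mono v c : WordAlgebra V)) = φ (mono v c) := by
    intro v c
    have h1 : π' (coe G (mono v 1 : WordAlgebra V)) = φ (mono v 1) := by
      induction v using FreeMonoid.inductionOn' with
      | one =>
        have : coe G (mono 1 1 : WordAlgebra V) = 1 := coe_one
        rw [this, map_one, ← one_eq_mono, map_one]
      | of_mul x v ih =>
        have h : (mono (FreeMonoid.of x * v) 1 : WordAlgebra V) =
            WordAlgebra.gen x * mono v 1 := by
          rw [WordAlgebra.gen, mono_mul, mul_one]
        have h' : coe G (WordAlgebra.gen x * mono v 1 : WordAlgebra V) =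
            u G x * coe G (mono v 1 : WordAlgebra V) := coe_mul _ _
        rw [h, h', map_mul, map_mul, ih, hπ', φ_gen]
    have h : (mono v c : WordAlgebra V) = c • mono v 1 := by rw [smul_mono, mul_one]
    have h' : coe G (c • mono v 1 : WordAlgebra V) = c • coe G (mono v 1 : WordAlgebra V) :=
      coe_smul _ _
    rw [h, h', map_smul, map_smul, h1]
  ext a
  refine induction (P := fun a => π' a = π a) (isClosed_eq cont' Ψ_cont) (fun a => ?_) a
  refine Eq.trans ?_ (Ψ_coe a).symm
  change π' (coe G a) = φ a
  induction a using WordAlgebra.induction with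
  | h0 => rw [map_zero]; exact (congrArg π' (Completion.coe_zero (α := G.PreB))).trans (map_zero π')
  | hadd a b ha hb =>
    exact (congrArg π' (coe_add a b)).trans ((map_add π' _ _).trans (by rw [ha, hb, map_add]))
  | hmono v c => exact eq_mono v c

end SimpleGraph.B

/-! ### Properties of C⋆-algebras -/

section Properties

open scoped TensorProduct

/-- A unital C⋆-algebra is AM (approximately matricial) if it is a direct limit of full matrix
algebras (with unital connecting maps), that is, if it is the closure of the union of an upwards
directed family of unital ⋆-subalgebras, each isomorphic to some `M_n(ℂ)` with `n ≥ 1`. -/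
def IsAM (A : Type*) [CStarAlgebra A] : Prop :=
  ∃ S : Set (StarSubalgebra ℂ A), S.Nonempty ∧ DirectedOn (· ≤ ·) S ∧
    (∀ D ∈ S, ∃ n : ℕ, 0 < n ∧ Nonempty (D ≃⋆ₐ[ℂ] Matrix (Fin n) (Fin n) ℂ)) ∧
    Dense (⋃ D ∈ S, (D : Set A))

/-- A C⋆-algebra is simple if it is nonzero and its only closed two-sided ideals are the trivial
ones. -/
def IsSimpleCStar (A : Type*) [NonUnitalCStarAlgebra A] : Prop :=
  Nontrivial A ∧ ∀ I : TwoSidedIdeal A, IsClosed (I : Set A) → I = ⊥ ∨ I = ⊤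

/-- A C⋆-algebra `A` is nuclear if for every C⋆-algebra `C` (unital or not) there is only one
C⋆-norm on the algebraic tensor product `A ⊗ C`. (For every pair of C⋆-algebras there is at least
one, the spatial norm, so that nuclearity is the assertion that any two C⋆-norms agree.) -/
def IsNuclear (A : Type u) [NonUnitalCStarAlgebra A] : Prop :=
  ∀ (C : Type v) [NonUnitalCStarAlgebra C], ∀ p q : CStarSeminorm (A ⊗[ℂ] C),
    p.IsNorm → q.IsNorm → ∀ t, p t = q t

/-- A C⋆-algebra is unital if it has a multiplicative identity. -/
def IsUnital (A : Type*) [NonUnitalCStarAlgebra A] : Prop :=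
  ∃ e : A, ∀ a, e * a = a ∧ a * e = a

/-- A normalized trace (tracial state) on a unital C⋆-algebra. -/
structure IsTracialState {A : Type*} [CStarAlgebra A] (τ : A →ₗ[ℂ] ℂ) : Prop where
  map_one : τ 1 = 1
  nonneg : ∀ a, 0 ≤ (τ (star a * a)).re ∧ (τ (star a * a)).im = 0
  tracial : ∀ a b, τ (a * b) = τ (b * a)

/-- A unital C⋆-algebra has a unique trace if it has exactly one tracial state. -/
def HasUniqueTrace (A : Type*) [CStarAlgebra A] : Prop :=
  ∃! τ : A →ₗ[ℂ] ℂ, IsTracialState τ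

end Properties

/-! ### Families of sets -/

/-- The bipartite graph `G(Y, 𝔸)` on the disjoint union of `Y` and `𝔸`, in which `i : Y` and
`x ∈ 𝔸` are adjacent if and only if `i ∈ x`. -/
def membershipGraph {Y : Type*} (𝔸 : Set (Set Y)) : SimpleGraph (Y ⊕ 𝔸) where
  Adj a b := (∃ (i : Y) (x : 𝔸), i ∈ x.1 ∧
    ((a = Sum.inl i ∧ b = Sum.inr x) ∨ (a = Sum.inr x ∧ b = Sum.inl i)))
  symm := ⟨by rintro a b ⟨i, x, h, h' | h'⟩ <;> exact ⟨i, x, h, by tauto⟩⟩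
  loopless := ⟨by rintro a ⟨i, x, _, ⟨rfl, h⟩ | ⟨rfl, h⟩⟩ <;> cases h⟩

/-- A family `𝔸` of subsets of `Y` is independent if `⋂ F \ ⋃ G` is nonempty for all finite
disjoint subfamilies `F ≠ ∅` and `G` of `𝔸`. -/
def IsIndependentFamily {Y : Type*} (𝔸 : Set (Set Y)) : Prop :=
  ∀ F G : Set (Set Y), F ⊆ 𝔸 → G ⊆ 𝔸 → F.Finite → G.Finite → Disjoint F G → F.Nonempty →
    (⋂₀ F \ ⋃₀ G).Nonempty

open Classical in
/-- A family `𝔸` of subsets of `Y` is dense in `2^Y`: the set of characteristic functions of its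
members is dense in the product of the discrete spaces `{0, 1}`. -/
def IsDenseFamily {Y : Type*} (𝔸 : Set (Set Y)) : Prop :=
  Dense ((fun (x : Set Y) (i : Y) => decide (i ∈ x)) '' 𝔸 : Set (Y → Bool))

/-! The core is that any finite set of generators of $B$ lies in a full matrix algebra contained in
the algebra generated by finitely many generators. By linear algebra over $\mathbb Z/2$, the
generators at members of $\mathbb A$ yield commuting involutions $W_s$, for $s$ a finitely supported
vector on $\mathbb A$; those at a finite set $Y_1\subseteq Y$ yield commuting involutions $U_t$; and
$W_sU_t=(-1)^{v(s)\cdot t}U_tW_s$, where $v$ is the incidence map to $(\mathbb Z/2)^{Y_1}$. For a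
linear section $c$ of $v$, the families $W_{c(s)}$ and $U_t$ form a Weyl pair (`IsWeylPair`), and a
Weyl pair spans matrix units of size $2^{|Y_1|}$.

Density makes $v$ surjective, so sections exist. Independence supplies, for each of the given
finitely many $x\in\mathbb A$, a point in $x$ and in none of the others. With these points in $Y_1$,
$v$ is injective on the span of the given $x$, and `LinearMap.exists_section_extending` lets $c$
return each $v(x)$ to $x$. The matrix algebra then contains the given generators; this is
`membershipGraph.isAM_B`. Signed shifts on $\ell^2$ show that $B\neq0$, so that the map from the
matrix algebra is injective.

The other properties hold for every AM algebra. For nuclearity and simplicity, an estimate on matrix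
subalgebras is first obtained up to a constant; iterated squaring with the C⋆-identity removes the
constant (`le_of_forall_pow_two_pow_le_mul`), and density finishes. A tracial state comes from the
normalized matrix traces by weak-⋆ compactness, and is unique because it is determined on each
matrix subalgebra. -/

open scoped TensorProduct

/-! ### C⋆-seminorms on C⋆-algebras -/

/-- Every self-adjoint contraction in a unital C⋆-algebra is the real part of a unitary. -/
theorem IsSelfAdjoint.exists_unitary_half_add_star {A : Type*} [CStarAlgebra A] {a : A}
    (ha : IsSelfAdjoint a) (h : ‖a‖ ≤ 1) :
    ∃ w : A, star w * w = 1 ∧ w * star w = 1 ∧ a = (2⁻¹ : ℂ) • (w + star w) := by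
  let := CStarAlgebra.spectralOrder A
  have := CStarAlgebra.spectralOrderedRing A
  let w := selfAdjoint.unitarySelfAddISMul ⟨a, ha⟩ h
  have hw : (w : A) = a + Complex.I • CFC.sqrt (1 - a ^ 2) := rfl
  have hw' : star (w : A) = a - Complex.I • CFC.sqrt (1 - a ^ 2) :=
    selfAdjoint.star_coe_unitarySelfAddISMul ⟨a, ha⟩ h
  refine ⟨w, Unitary.coe_star_mul_self w, Unitary.coe_mul_star_self w, ?_⟩
  rw [hw', hw, add_add_sub_cancel, ← two_smul ℂ a, smul_smul]
  norm_num

/-- If `y < x`, the powers of `x / y` outgrow `K`. This turns an estimate with a constant into one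
without, once it can be iterated under squaring. -/
theorem le_of_forall_pow_two_pow_le_mul {x y K : ℝ} (hy : 0 ≤ y)
    (h : ∀ k : ℕ, x ^ 2 ^ k ≤ K * y ^ 2 ^ k) : x ≤ y := by
  by_contra! hlt
  rcases hy.eq_or_lt with rfl | h0
  · simpa [hlt.not_ge] using h 0
  · obtain ⟨n, hn⟩ := pow_unbounded_of_one_lt K ((one_lt_div h0).2 hlt)
    have h2 : K < (x / y) ^ 2 ^ n :=
      hn.trans_le (pow_le_pow_right₀ ((one_lt_div h0).2 hlt).le Nat.lt_two_pow_self.le)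
    rw [div_pow, lt_div_iff₀ (pow_pos h0 _)] at h2
    exact absurd (h n) h2.not_ge

namespace CStarSeminorm

section

variable {R : Type*} [NonUnitalRing R] [StarRing R] [Module ℂ R] (p : CStarSeminorm R)

theorem nonneg (a : R) : 0 ≤ p a := apply_nonneg p.toSeminorm a

theorem add_le (a b : R) : p (a + b) ≤ p a + p b := map_add_le_add p.toSeminorm a b

theorem smul_eq (c : ℂ) (a : R) : p (c • a) = ‖c‖ * p a := map_smul_eq_mul p.toSeminorm c a

theorem apply_zero : p 0 = 0 := map_zero p.toSeminorm

theorem sum_le {ι : Type*} (s : Finset ι) (f : ι → R) : p (∑ i ∈ s, f i) ≤ ∑ i ∈ s, p (f i) :=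
  Finset.le_sum_of_subadditive p p.apply_zero.le p.add_le s f

/-- A unital C⋆-algebra that acts by adjointable operators acts by bounded operators, with respect
to any C⋆-seminorm. -/
theorem le_of_adjointable_action {A : Type*} [CStarAlgebra A] (L : A →ₗ[ℂ] R →ₗ[ℂ] R)
    (h1 : ∀ x, L 1 x = x)
    (hL : ∀ a b x y, star (L a x) * L b y = star x * L (star a * b) y) (a : A) (x : R) :
    p (L a x) ≤ ‖a‖ * p x := by
  -- With `star x * y` as inner product, an isometry `w` preserves the square of `x`, hence `p x` by
  -- the C⋆-identity. Averages of two unitaries then handle self-adjoint contractions.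
  have hu : ∀ w : A, star w * w = 1 → ∀ x, p (L w x) = p x := fun w hw x => by
    have h : p (L w x) ^ 2 = p x ^ 2 := by
      rw [← p.star_mul_self, ← p.star_mul_self, hL, hw, h1]
    exact (sq_eq_sq₀ (p.nonneg _) (p.nonneg _)).1 h
  have hsa1 : ∀ b : A, IsSelfAdjoint b → ‖b‖ ≤ 1 → ∀ x, p (L b x) ≤ p x := fun b hb hb1 x => by
    obtain ⟨w, hw, hw', rfl⟩ := hb.exists_unitary_half_add_star hb1
    have h2 := p.add_le (L w x) (L (star w) x)
    rw [hu w hw, hu (star w) (by rwa [star_star])] at h2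
    rw [map_smul, map_add, LinearMap.smul_apply, p.smul_eq, LinearMap.add_apply, norm_inv,
      Complex.norm_ofNat]
    linarith
  have hsa : ∀ b : A, IsSelfAdjoint b → ∀ x, p (L b x) ≤ ‖b‖ * p x := fun b hb x => by
    rcases eq_or_ne b 0 with rfl | h0
    · simp
    have hn : 0 < ‖b‖ := norm_pos_iff.2 h0
    have h := hsa1 ((‖b‖⁻¹ : ℝ) • b) (.smul (.all _) hb)
      (by rw [norm_smul, norm_inv, norm_norm, inv_mul_cancel₀ hn.ne']) x
    rw [← Complex.coe_smul, map_smul, LinearMap.smul_apply, p.smul_eq, Complex.norm_real, norm_inv,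
      norm_norm, inv_mul_le_iff₀ hn] at h
    exact h
  have h : p (L a x) ^ 2 ≤ (‖a‖ * p x) ^ 2 := by
    rw [← p.star_mul_self, hL]
    refine (p.mul_le _ _).trans ?_
    rw [p.star_eq]
    refine (mul_le_mul_of_nonneg_left (hsa _ (.star_mul_self a) x) (p.nonneg x)).trans ?_
    rw [CStarRing.norm_star_mul_self]
    exact le_of_eq (by ring)
  exact (sq_le_sq₀ (p.nonneg _) (mul_nonneg (norm_nonneg a) (p.nonneg x))).1 h

/-- If a C⋆-seminorm is dominated by a multiple of another one on a set that is closed under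
`t ↦ t⋆ t`, then it is dominated by the other one. -/
theorem le_of_le_mul {p q : CStarSeminorm R} {T : Set R} (hT : ∀ t ∈ T, star t * t ∈ T) {K : ℝ}
    (h : ∀ t ∈ T, p t ≤ K * q t) : ∀ t ∈ T, p t ≤ q t := by
  have key : ∀ k : ℕ, ∀ t ∈ T, p t ^ 2 ^ k ≤ K * q t ^ 2 ^ k := by
    intro k
    induction k with
    | zero => simpa using h
    | succ k ih =>
      intro t ht
      have := ih _ (hT t ht)
      rwa [p.star_mul_self, q.star_mul_self, ← pow_mul, ← pow_mul, ← pow_succ'] at this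
  exact fun t ht => le_of_forall_pow_two_pow_le_mul (q.nonneg t) fun k => key k t ht

end

/-! ### Comparison of C⋆-seminorms with the norm of a C⋆-algebra -/

section

variable {C : Type*} [NonUnitalCStarAlgebra C] (p : CStarSeminorm C)

/-- The unitization acts on `C` by left multiplication, and this action is adjointable. Letting
`star c` act on `c` gives `p c ^ 2 ≤ ‖c‖ * p c`. -/
theorem le_norm (c : C) : p c ≤ ‖c‖ := by
  let L : Unitization ℂ C →ₗ[ℂ] C →ₗ[ℂ] C :=
    LinearMap.mk₂ ℂ (fun a x => a.fst • x + a.snd * x)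
      (fun a b x => by simp only [Unitization.fst_add, Unitization.snd_add, add_smul, add_mul]; abel)
      (fun k a x => by simp [smul_smul, smul_add, smul_mul_assoc])
      (fun a x y => by simp only [smul_add, mul_add]; abel)
      (fun k a x => by simp [smul_comm k, smul_add, mul_smul_comm])
  have hL : ∀ a x, L a x = a.fst • x + a.snd * x := fun a x => rfl
  have h := p.le_of_adjointable_action L (fun x => by simp [hL]) (fun a b x y => by
    simp only [hL, star_add, star_smul, star_mul, Unitization.fst_mul, Unitization.snd_mul,
      Unitization.fst_star, Unitization.snd_star, mul_add, add_mul, smul_add, smul_mul_assoc,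
      mul_smul_comm, mul_smul, mul_assoc]
    rw [smul_comm (star a.fst) b.fst]
    abel) (star c : C) c
  rw [hL, Unitization.fst_inr, Unitization.snd_inr, zero_smul, zero_add, p.star_mul_self,
    Unitization.norm_inr, norm_star, pow_two] at h
  rcases (p.nonneg c).eq_or_lt with h0 | h0
  · exact h0 ▸ norm_nonneg c
  · exact le_of_mul_le_mul_right h h0

/-- The only C⋆-norm on a C⋆-algebra is the given one. -/
theorem IsNorm.eq_norm {p : CStarSeminorm C} (hp : p.IsNorm) (c : C) : p c = ‖c‖ := by
  have hsa : ∀ a : C, IsSelfAdjoint a → ‖a‖ ≤ p a := by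
    intro a ha
    by_contra! hlt
    obtain ⟨s, hrs, hs⟩ := exists_between hlt
    have hs0 : 0 < s := (p.nonneg a).trans_lt hrs
    -- If `p a < s < ‖a‖`, take `f` vanishing on `[-s, s]` and `m` with `t * m t = 1` off that
    -- interval and `|m| ≤ s⁻¹`. Then `f(a) = f(a) a m(a)`, where `p (a m(a)) ≤ p a / s < 1`. Hence
    -- `p (f(a)) = 0`, so `f(a) = 0`, which confines the spectrum of `a` to `[-s, s]`, a
    -- contradiction.
    let f : ℝ → ℝ := fun t => max (|t| - s) 0
    let m : ℝ → ℝ := fun t => t / max (t ^ 2) (s ^ 2)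
    have hM : ∀ t : ℝ, max (t ^ 2) (s ^ 2) ≠ 0 := fun t =>
      (lt_max_of_lt_right (pow_pos hs0 2)).ne'
    have hfc : Continuous f := by fun_prop
    have hmc : Continuous m := continuous_id.div (by fun_prop) hM
    have hf0 : f 0 = 0 := by simp [f, hs0.le]
    have hm0 : m 0 = 0 := by simp [m]
    have hfm : ∀ t, f t * (t * m t) = f t := fun t => by
      rcases le_total |t| s with h | h
      · simp [f, h]
      · have h2 : s ^ 2 ≤ t ^ 2 := by rw [← sq_abs t]; gcongr
        have h3 : t ≠ 0 := by rintro rfl; simp at h; linarith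
        simp only [m, max_eq_left h2]
        field_simp
    have hb : cfcₙ f a * (a * cfcₙ m a) = cfcₙ f a := by
      nth_rewrite 2 [← cfcₙ_id' ℝ a]
      rw [← cfcₙ_mul (fun t => t) m a, ← cfcₙ_mul f _ a]
      exact cfcₙ_congr fun t _ => hfm t
    have hm : p (cfcₙ m a) ≤ s⁻¹ := by
      refine (p.le_norm _).trans (norm_cfcₙ_le fun t _ => ?_)
      rw [Real.norm_eq_abs, abs_div, abs_of_pos (lt_max_of_lt_right (pow_pos hs0 2)),
        div_le_iff₀ (lt_max_of_lt_right (pow_pos hs0 2)), inv_mul_eq_div, le_div_iff₀ hs0]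
      rcases le_total |t| s with h | h
      · exact le_max_of_le_right (by nlinarith [abs_nonneg t])
      · exact le_max_of_le_left (by rw [← sq_abs]; nlinarith [abs_nonneg t])
    have hpb : p (cfcₙ f a) = 0 := by
      have h1 : p (cfcₙ f a) ≤ p (cfcₙ f a) * (p a * s⁻¹) := by
        nth_rewrite 1 [← hb]
        refine (p.mul_le _ _).trans (mul_le_mul_of_nonneg_left ?_ (p.nonneg _))
        exact (p.mul_le _ _).trans (mul_le_mul_of_nonneg_left hm (p.nonneg _))
      have h2 : p a * s⁻¹ < 1 := by rwa [← div_eq_mul_inv, div_lt_one hs0]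
      nlinarith [p.nonneg (cfcₙ f a)]
    have hle : ‖cfcₙ (fun t : ℝ => t) a‖ ≤ s := norm_cfcₙ_le fun t ht => by
      have := norm_apply_le_norm_cfcₙ f a ht
      rw [hp _ hpb, norm_zero] at this
      have h4 : f t = 0 := norm_le_zero_iff.1 this
      have h5 : |t| - s ≤ f t := le_max_left _ _
      rw [Real.norm_eq_abs]
      linarith
    rw [cfcₙ_id' ℝ a] at hle
    linarith
  refine le_antisymm (p.le_norm c) ?_
  have h := hsa _ (.star_mul_self c)
  rw [p.star_mul_self, CStarRing.norm_star_mul_self, ← pow_two] at h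
  exact (sq_le_sq₀ (norm_nonneg c) (p.nonneg c)).1 h

end

end CStarSeminorm

/-! ### Nuclearity of AM algebras -/

namespace StarSubalgebra

variable {A : Type*} [CStarAlgebra A] {D : StarSubalgebra ℂ A} {n : ℕ}

/-- The embedding of a matrix algebra onto a ⋆-subalgebra that is isomorphic to it. -/
noncomputable def matrixEmbedding (e : D ≃⋆ₐ[ℂ] Matrix (Fin n) (Fin n) ℂ) :
    Matrix (Fin n) (Fin n) ℂ →⋆ₐ[ℂ] A :=
  D.subtype.comp (e.symm : Matrix (Fin n) (Fin n) ℂ →⋆ₐ[ℂ] D)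

theorem matrixEmbedding_injective (e : D ≃⋆ₐ[ℂ] Matrix (Fin n) (Fin n) ℂ) :
    Function.Injective (matrixEmbedding e) :=
  Subtype.val_injective.comp e.symm.injective

theorem matrixEmbedding_mem (e : D ≃⋆ₐ[ℂ] Matrix (Fin n) (Fin n) ℂ) (m) :
    matrixEmbedding e m ∈ D := (e.symm m).2

theorem exists_matrixEmbedding_eq (e : D ≃⋆ₐ[ℂ] Matrix (Fin n) (Fin n) ℂ) {a : A} (ha : a ∈ D) :
    ∃ m, matrixEmbedding e m = a :=
  ⟨e ⟨a, ha⟩, congrArg Subtype.val (e.symm_apply_apply ⟨a, ha⟩)⟩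

end StarSubalgebra

/-! ### C⋆-norms on the tensor product with a matrix algebra -/

namespace CStarSeminorm

variable {A : Type*} [CStarAlgebra A] {C : Type*} [NonUnitalCStarAlgebra C]

/-- Slicing a C⋆-norm on `A ⊗ C` at a nonzero projection gives the norm of `C`. -/
theorem IsNorm.tmul_projection {p : CStarSeminorm (A ⊗[ℂ] C)} (hp : p.IsNorm) {e : A}
    (he : star e * e = e) (h0 : e ≠ 0) (c : C) : p (e ⊗ₜ c) = ‖c‖ := by
  have hs : star e = e := by rw [← he, star_mul, star_star]
  have hee : e * e = e := by rwa [hs] at he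
  let q : CStarSeminorm C :=
    { toSeminorm := p.toSeminorm.comp (TensorProduct.mk ℂ A C e)
      mul_le' := fun a b => by
        have h := p.mul_le (e ⊗ₜ a) (e ⊗ₜ b)
        rwa [Algebra.TensorProduct.tmul_mul_tmul, hee] at h
      star_mul_self' := fun a => by
        have h := p.star_mul_self (e ⊗ₜ a)
        rwa [TensorProduct.star_tmul, Algebra.TensorProduct.tmul_mul_tmul, he] at h }
  have hq : q.IsNorm := fun c hc => by
    have h := hp (e ⊗ₜ c) hc
    -- Slicing by a functional with value 1 at `e` recovers `c` from `e ⊗ c`.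
    obtain ⟨f, hf⟩ := Module.Projective.exists_dual_eq_one ℂ h0
    simpa [hf] using congrArg (fun t => TensorProduct.lid ℂ C (f.rTensor C t)) h
  exact hq.eq_norm c

/-- Left multiplication on the first leg is an adjointable action of `A`, which reduces the bound to
`1 ⊗ c`; and `c ↦ p (1 ⊗ c)` is a C⋆-seminorm on `C`, so `le_norm` applies. It lets approximation in
`A` carry over to every C⋆-seminorm on the tensor product. -/
theorem tmul_le (p : CStarSeminorm (A ⊗[ℂ] C)) (a : A) (c : C) : p (a ⊗ₜ c) ≤ ‖a‖ * ‖c‖ := by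
  let L : A →ₗ[ℂ] A ⊗[ℂ] C →ₗ[ℂ] A ⊗[ℂ] C :=
    (TensorProduct.mapBilinear (.id ℂ) A C A C).flip LinearMap.id ∘ₗ LinearMap.mul ℂ A
  have hL : ∀ a b c, L a (b ⊗ₜ c) = (a * b) ⊗ₜ c := fun a b c => rfl
  have h1 := p.le_of_adjointable_action L
    (fun x => by
      induction x with
      | zero => simp
      | tmul b c => rw [hL, one_mul]
      | add x y hx hy => rw [map_add, hx, hy])
    (fun a b x y => by
      induction x with
      | zero => simp
      | add x y hx hy => rw [map_add, star_add, star_add, add_mul, add_mul, hx, hy]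
      | tmul d c =>
        induction y with
        | zero => simp
        | add x y hx hy => rw [map_add, map_add, mul_add, mul_add, hx, hy]
        | tmul d' c' =>
          simp only [hL, TensorProduct.star_tmul, Algebra.TensorProduct.tmul_mul_tmul, star_mul,
            mul_assoc]) a (1 ⊗ₜ c)
  rw [hL, mul_one] at h1
  let q : CStarSeminorm C :=
    { toSeminorm := p.toSeminorm.comp (TensorProduct.mk ℂ A C 1)
      mul_le' := fun a b => by
        have h := p.mul_le (1 ⊗ₜ a) (1 ⊗ₜ b)
        rwa [Algebra.TensorProduct.tmul_mul_tmul, mul_one] at h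
      star_mul_self' := fun a => by
        have h := p.star_mul_self (1 ⊗ₜ a)
        rwa [TensorProduct.star_tmul, Algebra.TensorProduct.tmul_mul_tmul, star_one, mul_one] at h }
  exact h1.trans (mul_le_mul_of_nonneg_left (q.le_norm c) (norm_nonneg a))

variable {n : ℕ} (Ψ : Matrix (Fin n) (Fin n) ℂ →⋆ₐ[ℂ] A)

/-- The tensors of the form `∑ e_ij ⊗ c_ij`, where the `e_ij` are the images of the matrix units. -/
noncomputable def matrixTensors : Submodule ℂ (A ⊗[ℂ] C) :=
  LinearMap.range (∑ i, ∑ j, TensorProduct.mk ℂ A C (Ψ (Matrix.single i j 1)) ∘ₗ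
    LinearMap.proj j ∘ₗ LinearMap.proj i : (Fin n → Fin n → C) →ₗ[ℂ] A ⊗[ℂ] C)

theorem mem_matrixTensors {t : A ⊗[ℂ] C} : t ∈ matrixTensors Ψ ↔
    ∃ c : Fin n → Fin n → C, ∑ i, ∑ j, Ψ (Matrix.single i j 1) ⊗ₜ c i j = t := by
  simp [matrixTensors, LinearMap.mem_range]

theorem tmul_mem_matrixTensors (m : Matrix (Fin n) (Fin n) ℂ) (c : C) :
    Ψ m ⊗ₜ c ∈ (matrixTensors Ψ : Submodule ℂ (A ⊗[ℂ] C)) := by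
  rw [mem_matrixTensors]
  refine ⟨fun i j => m i j • c, ?_⟩
  conv_rhs => rw [Matrix.matrix_eq_sum_single m]
  simp only [map_sum, TensorProduct.sum_tmul]
  refine Finset.sum_congr rfl fun i _ => Finset.sum_congr rfl fun j _ => ?_
  rw [← TensorProduct.smul_tmul, ← map_smul, Matrix.smul_single, smul_eq_mul, mul_one]

theorem star_mul_self_mem_matrixTensors {t : A ⊗[ℂ] C} (ht : t ∈ matrixTensors Ψ) :
    star t * t ∈ matrixTensors Ψ := by
  obtain ⟨c, rfl⟩ := (mem_matrixTensors Ψ).1 ht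
  simp only [star_sum, Finset.sum_mul, Finset.mul_sum, TensorProduct.star_tmul,
    Algebra.TensorProduct.tmul_mul_tmul, ← map_star, ← map_mul]
  exact sum_mem fun i _ => sum_mem fun j _ => sum_mem fun k _ => sum_mem fun l _ =>
    tmul_mem_matrixTensors Ψ _ _

variable {Ψ}

/-- The C⋆-identity reduces the matrix unit $e_{ij}$ to the projection $e_{jj}$, covered by
`IsNorm.tmul_projection`. -/
theorem IsNorm.tmul_single (hΨ : Function.Injective Ψ) {p : CStarSeminorm (A ⊗[ℂ] C)}
    (hp : p.IsNorm) (i j : Fin n) (c : C) : p (Ψ (Matrix.single i j 1) ⊗ₜ c) = ‖c‖ := by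
  have hj : Ψ (Matrix.single j j 1) ≠ 0 := by
    rw [ne_eq, map_eq_zero_iff Ψ hΨ]
    intro h
    simpa using congrFun₂ h j j
  have h : p (Ψ (Matrix.single i j 1) ⊗ₜ c) ^ 2 = ‖c‖ ^ 2 := by
    rw [← p.star_mul_self, TensorProduct.star_tmul, Algebra.TensorProduct.tmul_mul_tmul,
      ← map_star, ← map_mul, Matrix.star_eq_conjTranspose, Matrix.conjTranspose_single, star_one,
      Matrix.single_mul_single_same, one_mul, hp.tmul_projection _ hj, CStarRing.norm_star_mul_self,
      pow_two]
    rw [← map_star, ← map_mul, Matrix.star_eq_conjTranspose, Matrix.conjTranspose_single, star_one,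
      Matrix.single_mul_single_same, one_mul]
  exact (sq_eq_sq₀ (p.nonneg _) (norm_nonneg _)).1 h

/-- Compressing by $e_{ii}$ and $e_{jj}$ isolates an entry. As `C` need not have a unit, the
compressing tensors carry `star d` in the second leg, where `d` is the entry itself; the resulting
powers of `‖d‖` cancel at the end. -/
theorem IsNorm.entry_le (hΨ : Function.Injective Ψ) {p : CStarSeminorm (A ⊗[ℂ] C)}
    (hp : p.IsNorm) (c : Fin n → Fin n → C) (i j : Fin n) :
    ‖c i j‖ ≤ p (∑ k, ∑ l, Ψ (Matrix.single k l 1) ⊗ₜ c k l) := by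
  set t : A ⊗[ℂ] C := ∑ k, ∑ l, Ψ (Matrix.single k l 1) ⊗ₜ c k l with ht
  set d := c i j
  have h1 : Ψ (Matrix.single i i 1) ⊗ₜ star d * t * Ψ (Matrix.single j j 1) ⊗ₜ star d =
      Ψ (Matrix.single i j 1) ⊗ₜ (star d * d * star d) := by
    simp only [ht, Finset.mul_sum, Finset.sum_mul, Algebra.TensorProduct.tmul_mul_tmul, ← map_mul]
    rw [Finset.sum_eq_single i, Finset.sum_eq_single j]
    · simp [d]
    · intro l _ hl; simp [hl]
    · simp
    · intro k _ hk; simp [hk.symm]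
    · simp
  have h2 := p.mul_le (Ψ (Matrix.single i i 1) ⊗ₜ star d * t) (Ψ (Matrix.single j j 1) ⊗ₜ star d)
  have h3 := p.mul_le (Ψ (Matrix.single i i 1) ⊗ₜ star d) t
  rw [h1, hp.tmul_single hΨ, hp.tmul_single hΨ, norm_star] at h2
  rw [hp.tmul_single hΨ, norm_star] at h3
  have h4 : ‖d‖ ^ 4 ≤ ‖star d * d * star d‖ * ‖d‖ := by
    refine le_trans (le_of_eq ?_) (norm_mul_le (star d * d * star d) d)
    have h5 : star d * d * star d * d = star (star d * d) * (star d * d) := by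
      simp only [star_mul, star_star, mul_assoc]
    rw [h5, CStarRing.norm_star_mul_self, CStarRing.norm_star_mul_self]
    ring
  rcases (norm_nonneg d).eq_or_lt with h0 | h0
  · rw [← h0]; exact p.nonneg t
  · have h6 : ‖d‖ ^ 3 * ‖d‖ ≤ ‖d‖ ^ 3 * p t := by
      calc ‖d‖ ^ 3 * ‖d‖ = ‖d‖ ^ 4 := by ring
        _ ≤ ‖star d * d * star d‖ * ‖d‖ := h4
        _ ≤ (‖d‖ * p t * ‖d‖) * ‖d‖ := by gcongr; exact h2.trans (by gcongr)
        _ = ‖d‖ ^ 3 * p t := by ring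
    exact le_of_mul_le_mul_left h6 (pow_pos h0 3)

/-- All C⋆-norms agree on single matrix units and dominate each entry, so two of them differ by a
factor of at most $n^2$, which `le_of_le_mul` removes. -/
theorem IsNorm.le_of_mem_matrixTensors (hΨ : Function.Injective Ψ)
    {p q : CStarSeminorm (A ⊗[ℂ] C)} (hp : p.IsNorm) (hq : q.IsNorm) {t : A ⊗[ℂ] C}
    (ht : t ∈ matrixTensors Ψ) : p t ≤ q t := by
  refine le_of_le_mul (T := (matrixTensors Ψ : Submodule ℂ (A ⊗[ℂ] C))) (K := n * n)
    (fun t => star_mul_self_mem_matrixTensors Ψ) (fun t ht => ?_) t ht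
  obtain ⟨c, rfl⟩ := (mem_matrixTensors Ψ).1 ht
  set t : A ⊗[ℂ] C := ∑ i, ∑ j, Ψ (Matrix.single i j 1) ⊗ₜ c i j
  calc p t ≤ ∑ i, ∑ j, p (Ψ (Matrix.single i j 1) ⊗ₜ c i j) :=
        (p.sum_le _ _).trans (Finset.sum_le_sum fun i _ => p.sum_le _ _)
    _ ≤ ∑ _i : Fin n, ∑ _j : Fin n, q t := Finset.sum_le_sum fun i _ => Finset.sum_le_sum fun j _ =>
        (hp.tmul_single hΨ i j _).trans_le (hq.entry_le hΨ c i j)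
    _ = n * n * q t := by simp [mul_assoc]

end CStarSeminorm

theorem IsAM.isNuclear {A : Type u} [CStarAlgebra A] (hA : IsAM A) : IsNuclear.{u, v} A := by
  obtain ⟨S, hne, hdir, hmat, hdense⟩ := hA
  have key : ∀ (C : Type v) [NonUnitalCStarAlgebra C] (p q : CStarSeminorm (A ⊗[ℂ] C)),
      p.IsNorm → q.IsNorm → ∀ t, p t ≤ q t := by
    intro C _ p q hp hq t
    let T : StarSubalgebra ℂ A → Submodule ℂ (A ⊗[ℂ] C) := fun D =>
      Submodule.span ℂ {t | ∃ d ∈ D, ∃ c : C, d ⊗ₜ c = t}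
    have hT : ∀ {D E : StarSubalgebra ℂ A}, D ≤ E → T D ≤ T E := fun h =>
      Submodule.span_mono fun _ ⟨d, hd, c, hc⟩ => ⟨d, h hd, c, hc⟩
    have approx : ∀ ε > 0, ∃ D ∈ S, ∃ s ∈ T D, p (t - s) < ε ∧ q (t - s) < ε := by
      induction t with
      | zero =>
        intro ε hε
        obtain ⟨D, hD⟩ := hne
        exact ⟨D, hD, 0, zero_mem _, by simpa, by simpa⟩
      | tmul a c =>
        intro ε hε
        -- Adding 1 keeps the divisor nonzero when `c = 0`.
        have hc : 0 < ‖c‖ + 1 := by positivity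
        obtain ⟨b, hb, hab⟩ := hdense.exists_dist_lt a (div_pos hε hc)
        obtain ⟨D, hD, hbD⟩ := Set.mem_iUnion₂.1 hb
        rw [dist_eq_norm, lt_div_iff₀ hc] at hab
        have h : ‖a - b‖ * ‖c‖ < ε := by nlinarith [norm_nonneg (a - b)]
        refine ⟨D, hD, b ⊗ₜ c, Submodule.subset_span ⟨b, hbD, c, rfl⟩, ?_, ?_⟩ <;>
        · rw [← TensorProduct.sub_tmul]
          exact (CStarSeminorm.tmul_le _ _ _).trans_lt h
      | add t₁ t₂ h₁ h₂ =>
        intro ε hε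
        obtain ⟨D₁, hD₁, s₁, hs₁, hp₁, hq₁⟩ := h₁ (ε / 2) (half_pos hε)
        obtain ⟨D₂, hD₂, s₂, hs₂, hp₂, hq₂⟩ := h₂ (ε / 2) (half_pos hε)
        obtain ⟨D, hD, h1, h2⟩ := hdir D₁ hD₁ D₂ hD₂
        have hsub : t₁ + t₂ - (s₁ + s₂) = (t₁ - s₁) + (t₂ - s₂) := by abel
        refine ⟨D, hD, s₁ + s₂, add_mem (hT h1 hs₁) (hT h2 hs₂), ?_, ?_⟩ <;> rw [hsub]
        · linarith [p.add_le (t₁ - s₁) (t₂ - s₂)]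
        · linarith [q.add_le (t₁ - s₁) (t₂ - s₂)]
    refine le_of_forall_pos_le_add fun ε hε => ?_
    obtain ⟨D, hD, s, hs, hps, hqs⟩ := approx (ε / 2) (half_pos hε)
    obtain ⟨n, -, ⟨e⟩⟩ := hmat D hD
    have hs' : s ∈ CStarSeminorm.matrixTensors (StarSubalgebra.matrixEmbedding e) := by
      refine Submodule.span_le.2 ?_ hs
      rintro _ ⟨d, hd, c, rfl⟩
      obtain ⟨m, rfl⟩ := StarSubalgebra.exists_matrixEmbedding_eq e hd
      exact CStarSeminorm.tmul_mem_matrixTensors _ m c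
    have h1 := hp.le_of_mem_matrixTensors (StarSubalgebra.matrixEmbedding_injective e) hq hs'
    have h2 := p.add_le (t - s) s
    have h3 := q.add_le (s - t) t
    have h4 : q (s - t) = q (t - s) := map_sub_rev q.toSeminorm s t
    rw [sub_add_cancel] at h2 h3
    linarith
  intro C _ p q hp hq t
  exact le_antisymm (key C p q hp hq t) (key C q p hq hp t)

/-! ### Simplicity and traces of AM algebras -/

section

open scoped Matrix.Norms.L2Operator

variable {A : Type*} [CStarAlgebra A] {n : ℕ}

theorem TwoSidedIdeal.smul_mem_of_algebra {R B : Type*} [CommRing R] [Ring B] [Algebra R B]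
    (I : TwoSidedIdeal B) (c : R) {x : B} (hx : x ∈ I) : c • x ∈ I := by
  rw [Algebra.smul_def]
  exact I.mul_mem_left _ _ hx

/-- A proper closed ideal has distance at least `‖a‖` from every element `a` of a full matrix
subalgebra. -/
theorem TwoSidedIdeal.norm_le_norm_sub_of_matrix [NeZero n] {I : TwoSidedIdeal A}
    (hI : IsClosed (I : Set A)) (h1 : (1 : A) ∉ I) {Ψ : Matrix (Fin n) (Fin n) ℂ →⋆ₐ[ℂ] A}
    (hΨ : Function.Injective Ψ) (m : Matrix (Fin n) (Fin n) ℂ) {i : A} (hi : i ∈ I) :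
    ‖Ψ m‖ ≤ ‖Ψ m - i‖ := by
  have hiso : ∀ m, ‖Ψ m‖ = ‖m‖ := NonUnitalStarAlgHom.norm_map Ψ hΨ
  have hcont : Continuous Ψ := (NonUnitalStarAlgHom.isometry Ψ hΨ).continuous
  -- The matrix algebra is algebraically simple, and the preimage of `I` omits 1.
  have hbot : ∀ m, Ψ m ∈ I → m = 0 := by
    intro m hm
    rcases eq_bot_or_eq_top (TwoSidedIdeal.comap Ψ I) with h | h
    · rw [← TwoSidedIdeal.mem_comap, h] at hm
      exact hm
    · have : (1 : Matrix (Fin n) (Fin n) ℂ) ∈ TwoSidedIdeal.comap Ψ I := h ▸ trivial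
      rw [TwoSidedIdeal.mem_comap, map_one] at this
      exact absurd this h1
  have hne : (I : Set A).Nonempty := ⟨0, I.zero_mem⟩
  -- Compactness of the unit sphere of a finite-dimensional space makes the distance to `I` bounded
  -- below there by some `c > 0`.
  obtain ⟨m₀, hm₀, hmin⟩ := (isCompact_sphere (0 : Matrix (Fin n) (Fin n) ℂ) 1).exists_isMinOn
    (NormedSpace.sphere_nonempty.2 zero_le_one)
    (f := fun m => Metric.infDist (Ψ m) (I : Set A))
    ((Metric.continuous_infDist_pt _).comp hcont).continuousOn
  set c := Metric.infDist (Ψ m₀) (I : Set A)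
  have hc : 0 < c := by
    refine (hI.notMem_iff_infDist_pos hne).1 fun h => ?_
    rw [hbot m₀ h] at hm₀
    simp at hm₀
  have hdist : ∀ m, ∀ i ∈ I, ‖m‖ ≤ c⁻¹ * ‖Ψ m - i‖ := by
    intro m i hi
    rcases eq_or_ne m 0 with rfl | h0
    · rw [norm_zero]; positivity
    have hm : 0 < ‖m‖ := norm_pos_iff.2 h0
    have hs : (‖m‖⁻¹ : ℂ) • m ∈ Metric.sphere (0 : Matrix (Fin n) (Fin n) ℂ) 1 := by
      rw [mem_sphere_zero_iff_norm, norm_smul, norm_inv, Complex.norm_real, norm_norm,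
        inv_mul_cancel₀ hm.ne']
    have h2 := (hmin hs).trans
      (Metric.infDist_le_dist_of_mem (I.smul_mem_of_algebra (‖m‖⁻¹ : ℂ) hi))
    rw [map_smul, dist_eq_norm, ← smul_sub, norm_smul, norm_inv, Complex.norm_real, norm_norm,
      le_inv_mul_iff₀ hm] at h2
    rwa [le_inv_mul_iff₀ hc, mul_comm]
  -- The square of `Ψ m - i` again has the form `Ψ (m * m) - i'` with `i' ∈ I`, so the estimate of
  -- `hdist` can be iterated; for self-adjoint `m` the left side squares exactly.
  have hpow : ∀ k : ℕ, ∀ m, IsSelfAdjoint m → ∀ i ∈ I, ‖m‖ ^ 2 ^ k ≤ c⁻¹ * ‖Ψ m - i‖ ^ 2 ^ k := by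
    intro k
    induction k with
    | zero => simpa using fun m _ => hdist m
    | succ k ih =>
      intro m hm i hi
      have h := ih (m * m) (by rw [IsSelfAdjoint, star_mul, hm.star_eq])
        (Ψ m * i + i * Ψ m - i * i)
        (I.sub_mem (I.add_mem (I.mul_mem_left _ _ hi) (I.mul_mem_right _ _ hi))
          (I.mul_mem_left _ _ hi))
      have h2 : Ψ (m * m) - (Ψ m * i + i * Ψ m - i * i) = (Ψ m - i) * (Ψ m - i) := by
        rw [map_mul]; noncomm_ring
      rw [h2, hm.norm_mul_self, ← pow_mul, ← pow_succ'] at h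
      refine h.trans (mul_le_mul_of_nonneg_left ?_ (inv_nonneg.2 hc.le))
      rw [pow_succ' 2 k, pow_mul, pow_two]
      exact pow_le_pow_left₀ (norm_nonneg _) (norm_mul_le _ _) _
  have hsa : ‖star m * m‖ ≤ ‖Ψ (star m * m) - star (Ψ m) * i‖ :=
    le_of_forall_pow_two_pow_le_mul (norm_nonneg _) fun k =>
      hpow k _ (.star_mul_self m) _ (I.mul_mem_left _ _ hi)
  rw [map_mul, map_star, ← mul_sub, CStarRing.norm_star_mul_self, ← hiso] at hsa
  have h3 := hsa.trans (norm_mul_le _ _)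
  rw [norm_star] at h3
  rcases (norm_nonneg (Ψ m)).eq_or_lt with h0 | h0
  · rw [← h0]; exact norm_nonneg _
  · exact le_of_mul_le_mul_left h3 h0

/-- For a proper closed ideal, the inequality `‖a‖ ≤ ‖a - i‖` passes from the matrix subalgebras to
all `a` by density; taking `a = i` shows that the ideal is zero. -/
theorem IsAM.isSimpleCStar (hA : IsAM A) : IsSimpleCStar A := by
  obtain ⟨S, ⟨D₀, hD₀⟩, -, hmat, hdense⟩ := hA
  refine ⟨?_, fun I hI => ?_⟩
  · obtain ⟨n, hn, ⟨e⟩⟩ := hmat D₀ hD₀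
    have : NeZero n := ⟨hn.ne'⟩
    exact (StarSubalgebra.matrixEmbedding_injective e).nontrivial
  · by_cases h1 : (1 : A) ∈ I
    · right
      exact (TwoSidedIdeal.one_mem_iff I).1 h1
    · left
      have key : ∀ a, ∀ i ∈ I, ‖a‖ ≤ ‖a - i‖ := by
        intro a i hi
        refine hdense.induction (P := fun a => ‖a‖ ≤ ‖a - i‖) (fun a ha => ?_)
          (isClosed_le (by fun_prop) (by fun_prop)) a
        obtain ⟨D, hD, ha⟩ := Set.mem_iUnion₂.1 ha
        obtain ⟨n, hn, ⟨e⟩⟩ := hmat D hD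
        have : NeZero n := ⟨hn.ne'⟩
        obtain ⟨m, rfl⟩ := StarSubalgebra.exists_matrixEmbedding_eq e ha
        exact TwoSidedIdeal.norm_le_norm_sub_of_matrix hI h1
          (StarSubalgebra.matrixEmbedding_injective e) m hi
      refine eq_bot_iff.2 fun a ha => ?_
      have := key a a ha
      rw [sub_self, norm_zero, norm_le_zero_iff] at this
      exact this

/-! ### Tracial states of AM algebras -/

theorem Matrix.norm_entry_le_l2_opNorm (m : Matrix (Fin n) (Fin n) ℂ) (i j : Fin n) :
    ‖m i j‖ ≤ ‖m‖ := by
  have h := m.l2_opNorm_mulVec (EuclideanSpace.single j 1)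
  rw [PiLp.norm_single, norm_one, mul_one] at h
  refine le_trans (le_of_eq ?_) ((PiLp.norm_apply_le _ i).trans h)
  simp

theorem Matrix.norm_trace_le (m : Matrix (Fin n) (Fin n) ℂ) : ‖m.trace‖ ≤ n * ‖m‖ :=
  (norm_sum_le _ _).trans ((Finset.sum_le_sum fun i _ => m.norm_entry_le_l2_opNorm i i).trans
    (by simp))

/-- The normalized trace is the only tracial functional on a matrix algebra, up to a scalar. -/
theorem Matrix.tracial_eq_smul_trace {K : Type*} [Field K] {n : ℕ}
    (f : Matrix (Fin n) (Fin n) K →ₗ[K] K) (hf : ∀ a b, f (a * b) = f (b * a))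
    (m : Matrix (Fin n) (Fin n) K) : n * f m = f 1 * m.trace := by
  -- Here $e_{ii}e_{ij}=e_{ij}$ while $e_{ij}e_{ii}=0$; similarly $e_{ij}e_{ji}=e_{ii}$ and
  -- $e_{ji}e_{ij}=e_{jj}$ give `heq`.
  have hne : ∀ i j, i ≠ j → f (single i j 1) = 0 := fun i j h => by
    have := hf (single i i 1) (single i j 1)
    simpa [h.symm] using this
  have heq : ∀ i j, f (single i i 1) = f (single j j 1) := fun i j => by
    simpa using hf (single i j 1) (single j i 1)
  have hm : ∀ j, f m = ∑ i, m i i * f (single j j 1) := fun j => by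
    conv_lhs => rw [matrix_eq_sum_single m]
    simp only [map_sum]
    refine Finset.sum_congr rfl fun i _ => ?_
    rw [Finset.sum_eq_single i]
    · rw [heq j i, ← smul_eq_mul, ← map_smul, smul_single, smul_eq_mul, mul_one]
    · intro k _ hk
      have : single i k (m i k) = m i k • single i k (1 : K) := by
        rw [smul_single, smul_eq_mul, mul_one]
      rw [this, map_smul, hne i k hk.symm, smul_zero]
    · simp
  have h1 : f 1 = ∑ j, f (single j j 1) := by
    rw [← map_sum, sum_single_one]
  rw [h1, Finset.sum_mul]
  calc n * f m = ∑ _j : Fin n, f m := by simp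
    _ = _ := Finset.sum_congr rfl fun j _ => by
      rw [hm j, ← Finset.sum_mul, mul_comm]; rfl

/-- The normalized trace of a full matrix subalgebra extends to a contractive functional. -/
theorem StarSubalgebra.exists_dual_tracial [NeZero n] {D : StarSubalgebra ℂ A}
    (e : D ≃⋆ₐ[ℂ] Matrix (Fin n) (Fin n) ℂ) : ∃ φ : StrongDual ℂ A, ‖φ‖ ≤ 1 ∧ φ 1 = 1 ∧
      (∀ a ∈ D, ∀ b ∈ D, φ (a * b) = φ (b * a)) ∧
      ∀ a ∈ D, 0 ≤ (φ (star a * a)).re ∧ (φ (star a * a)).im = 0 := by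
  have hn : (n : ℂ) ≠ 0 := NeZero.ne _
  have hn' : (0 : ℝ) < n := Nat.cast_pos.2 (NeZero.pos n)
  have hiso : ∀ x : D, ‖e x‖ = ‖(x : A)‖ := fun x => by
    have h := NonUnitalStarAlgHom.norm_map (matrixEmbedding e) (matrixEmbedding_injective e) (e x)
    rw [← h]
    exact congrArg (fun y : D => ‖(y : A)‖) (e.symm_apply_apply x)
  let f₀ : D.toSubalgebra.toSubmodule →ₗ[ℂ] ℂ :=
    { toFun := fun x => (n : ℂ)⁻¹ * (e x).trace
      map_add' := fun x y => by
        rw [← mul_add, ← Matrix.trace_add]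
        exact congrArg (fun m => (n : ℂ)⁻¹ * Matrix.trace m) (map_add e x y)
      map_smul' := fun c x => by
        have h : e (c • x) = c • e x := map_smul e c _
        rw [RingHom.id_apply, smul_eq_mul, mul_left_comm, ← smul_eq_mul c, ← Matrix.trace_smul, ← h] }
  let f : StrongDual ℂ D.toSubalgebra.toSubmodule := f₀.mkContinuous 1 fun x => by
    change ‖(n : ℂ)⁻¹ * (e x).trace‖ ≤ 1 * ‖(x : A)‖
    rw [norm_mul, norm_inv, Complex.norm_natCast, one_mul, inv_mul_le_iff₀ hn', ← hiso]
    exact Matrix.norm_trace_le _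
  -- Hahn–Banach: the extension keeps the norm bound but is tracial and positive only on `D`, which
  -- suffices for the compactness argument.
  obtain ⟨φ, hφ, hnorm⟩ := exists_extension_norm_eq _ f
  have hφ' : ∀ x : D, φ (x : A) = (n : ℂ)⁻¹ * (e x).trace := fun x => hφ x
  refine ⟨φ, hnorm.trans_le (f₀.mkContinuous_norm_le zero_le_one _), ?_, fun a ha b hb => ?_,
    fun a ha => ?_⟩
  · have h := hφ' 1
    rw [map_one, Matrix.trace_one, Fintype.card_fin, inv_mul_cancel₀ hn] at h
    exact h
  · have h1 := hφ' (⟨a, ha⟩ * ⟨b, hb⟩)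
    rw [map_mul, Matrix.trace_mul_comm, ← map_mul, ← hφ'] at h1
    exact h1
  · have h1 : φ (star a * a) = _ := hφ' (star ⟨a, ha⟩ * ⟨a, ha⟩)
    rw [map_mul e, map_star e] at h1
    have h2 : (e ⟨a, ha⟩).conjTranspose * e ⟨a, ha⟩ = star (e ⟨a, ha⟩) * e ⟨a, ha⟩ := rfl
    open ComplexOrder in
    have h3 := (Matrix.posSemidef_conjTranspose_mul_self (e ⟨a, ha⟩)).trace_nonneg
    rw [h2, Complex.nonneg_iff] at h3
    have h4 : ((n : ℂ)⁻¹) = ((n : ℝ)⁻¹ : ℝ) := by push_cast; rfl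
    rw [h1, h4, Complex.re_ofReal_mul, Complex.im_ofReal_mul, ← h3.2, mul_zero]
    exact ⟨mul_nonneg (inv_nonneg.2 hn'.le) h3.1, rfl⟩

/-- Positive functionals on a C⋆-algebra are automatically bounded, so agreement on a dense subset
suffices for uniqueness. -/
theorem IsTracialState.continuous {τ : A →ₗ[ℂ] ℂ} (hτ : IsTracialState τ) : Continuous τ := by
  let := CStarAlgebra.spectralOrder A
  have := CStarAlgebra.spectralOrderedRing A
  open ComplexOrder in
  let f : A →ₚ[ℂ] ℂ := PositiveLinearMap.mk₀ τ fun x hx => by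
    obtain ⟨b, rfl⟩ := CStarAlgebra.nonneg_iff_eq_star_mul_self.1 hx
    exact Complex.nonneg_iff.2 ⟨(hτ.nonneg b).1, (hτ.nonneg b).2.symm⟩
  obtain ⟨K, hK⟩ := f.exists_norm_apply_le
  exact AddMonoidHomClass.continuous_of_bound τ K hK

theorem IsAM.hasUniqueTrace (hA : IsAM A) : HasUniqueTrace A := by
  obtain ⟨S, ⟨D₀, hD₀⟩, hdir, hmat, hdense⟩ := hA
  -- Contractive functionals that behave like a tracial state on `D`. These sets are nonempty and
  -- weak-⋆ compact, and they shrink as `D` grows; directedness of `S` gives a common point.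
  let K : S → Set (WeakDual ℂ A) := fun D =>
    WeakDual.toStrongDual ⁻¹' Metric.closedBall 0 1 ∩ {φ | φ 1 = 1 ∧
      (∀ a ∈ D.1, ∀ b ∈ D.1, φ (a * b) = φ (b * a)) ∧
      ∀ a ∈ D.1, 0 ≤ (φ (star a * a)).re ∧ (φ (star a * a)).im = 0}
  have hKcl : ∀ D, IsClosed (K D) := fun D => by
    refine (WeakDual.isClosed_closedBall 0 1).inter ?_
    have ev : ∀ x : A, Continuous fun φ : WeakDual ℂ A => φ x := WeakDual.eval_continuous
    refine (isClosed_eq (ev _) continuous_const).inter (IsClosed.inter ?_ ?_)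
    · change IsClosed {φ : WeakDual ℂ A | ∀ a ∈ D.1, ∀ b ∈ D.1, φ (a * b) = φ (b * a)}
      simp only [Set.ofPred_forall]
      exact isClosed_iInter fun a => isClosed_iInter fun _ => isClosed_iInter fun b =>
        isClosed_iInter fun _ => isClosed_eq (ev _) (ev _)
    · change IsClosed {φ : WeakDual ℂ A |
        ∀ a ∈ D.1, 0 ≤ (φ (star a * a)).re ∧ (φ (star a * a)).im = 0}
      simp only [Set.ofPred_forall]
      exact isClosed_iInter fun a => isClosed_iInter fun _ =>
        (isClosed_le continuous_const (Complex.continuous_re.comp (ev _))).inter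
          (isClosed_eq (Complex.continuous_im.comp (ev _)) continuous_const)
  have hKanti : ∀ D E : S, D.1 ≤ E.1 → K E ⊆ K D := fun D E h φ hφ =>
    ⟨hφ.1, hφ.2.1, fun a ha b hb => hφ.2.2.1 a (h ha) b (h hb), fun a ha => hφ.2.2.2 a (h ha)⟩
  have : Nonempty S := ⟨⟨D₀, hD₀⟩⟩
  obtain ⟨φ, hφ⟩ := IsCompact.nonempty_iInter_of_directed_nonempty_isCompact_isClosed K
    (fun D E => by
      obtain ⟨F, hF, h1, h2⟩ := hdir D.1 D.2 E.1 E.2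
      exact ⟨⟨F, hF⟩, hKanti D ⟨F, hF⟩ h1, hKanti E ⟨F, hF⟩ h2⟩)
    (fun D => by
      obtain ⟨n, hn, ⟨e⟩⟩ := hmat D.1 D.2
      have : NeZero n := ⟨hn.ne'⟩
      obtain ⟨φ, h1, h2⟩ := StarSubalgebra.exists_dual_tracial e
      exact ⟨StrongDual.toWeakDual φ, mem_closedBall_zero_iff.2 h1, h2⟩)
    (fun D => (WeakDual.isCompact_closedBall 0 1).of_isClosed_subset (hKcl D)
      Set.inter_subset_left) hKcl
  rw [Set.mem_iInter] at hφ
  have hφc : Continuous φ := (WeakDual.toStrongDual φ).continuous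
  refine ⟨(WeakDual.toStrongDual φ : A →ₗ[ℂ] ℂ), ⟨(hφ ⟨D₀, hD₀⟩).2.1, fun a => ?_, fun a b => ?_⟩,
    fun τ hτ => ?_⟩
  · refine hdense.induction (P := fun a => 0 ≤ (φ (star a * a)).re ∧ (φ (star a * a)).im = 0)
      (fun a ha => ?_) ?_ a
    · obtain ⟨D, hD, ha⟩ := Set.mem_iUnion₂.1 ha
      exact (hφ ⟨D, hD⟩).2.2.2 a ha
    · have h : Continuous fun a => φ (star a * a) := by fun_prop
      exact (isClosed_le continuous_const (Complex.continuous_re.comp h)).inter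
        (isClosed_eq (Complex.continuous_im.comp h) continuous_const)
  · refine hdense.induction (P := fun a => φ (a * b) = φ (b * a)) (fun a ha => ?_)
      (isClosed_eq (by fun_prop) (by fun_prop)) a
    refine hdense.induction (P := fun b => φ (a * b) = φ (b * a)) (fun b hb => ?_)
      (isClosed_eq (by fun_prop) (by fun_prop)) b
    obtain ⟨D, hD, ha⟩ := Set.mem_iUnion₂.1 ha
    obtain ⟨E, hE, hb⟩ := Set.mem_iUnion₂.1 hb
    obtain ⟨F, hF, h1, h2⟩ := hdir D hD E hE
    exact (hφ ⟨F, hF⟩).2.2.1 a (h1 ha) b (h2 hb)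
  · ext a
    refine hdense.induction (P := fun a => τ a = φ a) (fun a ha => ?_)
      (isClosed_eq hτ.continuous hφc) a
    obtain ⟨D, hD, ha⟩ := Set.mem_iUnion₂.1 ha
    obtain ⟨n, hn, ⟨e⟩⟩ := hmat D hD
    let Ψ := StarSubalgebra.matrixEmbedding e
    obtain ⟨m, rfl⟩ := StarSubalgebra.exists_matrixEmbedding_eq e ha
    have h1 := Matrix.tracial_eq_smul_trace (τ ∘ₗ (Ψ : Matrix (Fin n) (Fin n) ℂ →ₗ[ℂ] A))
      (fun a b => by simp [map_mul, hτ.tracial (Ψ a)]) m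
    have h2 := Matrix.tracial_eq_smul_trace
      ((WeakDual.toStrongDual φ : A →ₗ[ℂ] ℂ) ∘ₗ (Ψ : Matrix (Fin n) (Fin n) ℂ →ₗ[ℂ] A))
      (fun a b => by
        have := (hφ ⟨D, hD⟩).2.2.1 (Ψ a) (StarSubalgebra.matrixEmbedding_mem e a) (Ψ b)
          (StarSubalgebra.matrixEmbedding_mem e b)
        rw [← map_mul, ← map_mul] at this
        exact this) m
    have e1 : τ (Ψ 1) = 1 := by rw [map_one, hτ.map_one]
    have e2 : φ (Ψ 1) = 1 := by rw [map_one]; exact (hφ ⟨D, hD⟩).2.1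
    have h3 : (n : ℂ) * τ (Ψ m) = n * φ (Ψ m) := by
      refine h1.trans (Eq.trans ?_ h2.symm)
      exact congrArg (· * m.trace) (e1.trans e2.symm)
    exact mul_left_cancel₀ (Nat.cast_ne_zero.2 hn.ne') h3

end

/-! ### Matrix units from Weyl pairs -/

section WeylPair

variable {A : Type*} [Ring A] [StarRing A] [Algebra ℂ A] [StarModule ℂ A]

/-- A system of matrix units in a ⋆-algebra determines a ⋆-homomorphism from a matrix algebra. -/
noncomputable def StarAlgHom.ofMatrixUnits {ι : Type*} [Fintype ι] [DecidableEq ι] (E : ι → ι → A)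
    (hmul : ∀ i j k l, E i j * E k l = if j = k then E i l else 0) (hone : ∑ i, E i i = 1)
    (hstar : ∀ i j, star (E i j) = E j i) : Matrix ι ι ℂ →⋆ₐ[ℂ] A :=
  { AlgHom.ofLinearMap
      (∑ i, ∑ j, (LinearMap.toSpanSingleton ℂ A (E i j)) ∘ₗ Matrix.entryLinearMap ℂ ℂ i j)
      (by simpa [Matrix.one_apply] using hone)
      (fun a b => by
        simp only [LinearMap.coe_sum, Finset.sum_apply, LinearMap.comp_apply,
          Matrix.entryLinearMap_apply, LinearMap.toSpanSingleton_apply]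
        rw [Finset.sum_mul]
        refine Finset.sum_congr rfl fun i _ => ?_
        have h : ∀ j, a i j • E i j * ∑ k, ∑ l, b k l • E k l = ∑ l, (a i j * b j l) • E i l := by
          intro j
          rw [Finset.mul_sum, Finset.sum_eq_single j]
          · simp [Finset.mul_sum, hmul, smul_smul, mul_comm]
          · intro k _ hk
            simp [Finset.mul_sum, hmul, hk.symm]
          · simp
        simp only [Finset.sum_mul, h, Matrix.mul_apply, Finset.sum_smul]
        exact Finset.sum_comm) with
    map_star' := fun a => by
      change (∑ i, ∑ j, (LinearMap.toSpanSingleton ℂ A (E i j)) ∘ₗ Matrix.entryLinearMap ℂ ℂ i j)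
        (star a) = star ((∑ i, ∑ j, (LinearMap.toSpanSingleton ℂ A (E i j)) ∘ₗ
          Matrix.entryLinearMap ℂ ℂ i j) a)
      simp only [LinearMap.coe_sum, Finset.sum_apply, LinearMap.comp_apply,
        Matrix.entryLinearMap_apply, LinearMap.toSpanSingleton_apply, star_sum, star_smul, hstar,
        Matrix.star_apply]
      exact Finset.sum_comm }

theorem StarAlgHom.ofMatrixUnits_apply {ι : Type*} [Fintype ι] [DecidableEq ι] (E : ι → ι → A)
    (hmul hone hstar) (m : Matrix ι ι ℂ) :
    StarAlgHom.ofMatrixUnits E hmul hone hstar m = ∑ i, ∑ j, m i j • E i j := by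
  change (∑ i, ∑ j, (LinearMap.toSpanSingleton ℂ A (E i j)) ∘ₗ Matrix.entryLinearMap ℂ ℂ i j) m = _
  simp

theorem StarAlgHom.ofMatrixUnits_single {ι : Type*} [Fintype ι] [DecidableEq ι] (E : ι → ι → A)
    (hmul hone hstar) (i j : ι) :
    StarAlgHom.ofMatrixUnits E hmul hone hstar (Matrix.single i j 1) = E i j := by
  rw [StarAlgHom.ofMatrixUnits_apply, Finset.sum_eq_single i, Finset.sum_eq_single j]
  · simp
  · intro k _ hk; simp [hk.symm]
  · simp
  · intro k _ hk; simp [hk.symm]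
  · simp

/-- The sign `(-1) ^ z` for `z : ℤ/2`. -/
def zmodTwoSign (z : ZMod 2) : ℂ := if z = 0 then 1 else -1

@[simp] theorem zmodTwoSign_zero : zmodTwoSign 0 = 1 := rfl

@[simp] theorem zmodTwoSign_one : zmodTwoSign 1 = -1 := rfl

theorem ZMod.two_eq_zero_or_one : ∀ z : ZMod 2, z = 0 ∨ z = 1 := by decide

theorem zmodTwoSign_add (a b : ZMod 2) : zmodTwoSign (a + b) = zmodTwoSign a * zmodTwoSign b := by
  have h11 : (1 + 1 : ZMod 2) = 0 := rfl
  rcases ZMod.two_eq_zero_or_one a with rfl | rfl <;>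
  rcases ZMod.two_eq_zero_or_one b with rfl | rfl <;> simp [h11]

theorem ZMod.pi_two_add_self {J : Type*} (s : J → ZMod 2) : s + s = 0 :=
  funext fun _ => CharTwo.add_self_eq_zero _

theorem ZMod.pi_two_add_eq_zero {J : Type*} {s t : J → ZMod 2} : s + t = 0 ↔ s = t := by
  rw [← ZMod.pi_two_add_self t, add_left_inj]

theorem zmodTwoSign_mul_self (a : ZMod 2) : zmodTwoSign a * zmodTwoSign a = 1 := by
  rw [← zmodTwoSign_add, CharTwo.add_self_eq_zero, zmodTwoSign_zero]

theorem star_zmodTwoSign (a : ZMod 2) : star (zmodTwoSign a) = zmodTwoSign a := by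
  rcases ZMod.two_eq_zero_or_one a with rfl | rfl <;> simp

theorem norm_zmodTwoSign (a : ZMod 2) : ‖zmodTwoSign a‖ = 1 := by
  rcases ZMod.two_eq_zero_or_one a with rfl | rfl <;> simp

theorem sum_zmodTwoSign_dotProduct {J : Type*} [Fintype J] [DecidableEq J] (t : J → ZMod 2) :
    ∑ s, zmodTwoSign (s ⬝ᵥ t) = if t = 0 then (Fintype.card (J → ZMod 2) : ℂ) else 0 := by
  split_ifs with h
  · simp [h]
  · obtain ⟨j, hj⟩ := Function.ne_iff.1 h
    have hj1 : t j = 1 := (ZMod.two_eq_zero_or_one _).resolve_left hj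
    -- Translation by the basis vector at a coordinate where `t` is 1 flips every sign, so the sum
    -- equals its own negative.
    have h2 := Fintype.sum_equiv (Equiv.addRight (Pi.single j 1))
      (fun s => -zmodTwoSign (s ⬝ᵥ t)) (fun s => zmodTwoSign (s ⬝ᵥ t)) fun s => by
        simp [add_dotProduct, zmodTwoSign_add, hj1]
    rw [Finset.sum_neg_distrib] at h2
    exact self_eq_neg.1 h2.symm

/-- A pair of representations of `(ℤ/2)^J` by self-adjoint unitaries that satisfy the Weyl
commutation relations. -/
structure IsWeylPair {J : Type*} [Fintype J] (W U : (J → ZMod 2) → A) : Prop where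
  W_zero : W 0 = 1
  W_add : ∀ s t, W (s + t) = W s * W t
  star_W : ∀ s, star (W s) = W s
  U_zero : U 0 = 1
  U_add : ∀ s t, U (s + t) = U s * U t
  star_U : ∀ s, star (U s) = U s
  comm : ∀ s t, W s * U t = zmodTwoSign (s ⬝ᵥ t) • (U t * W s)

namespace IsWeylPair

variable {J : Type*} [Fintype J] [DecidableEq J] {W U : (J → ZMod 2) → A}

/-- The spectral projection of the commuting involutions `U t` at the character `s`. -/
noncomputable def proj (U : (J → ZMod 2) → A) (s : J → ZMod 2) : A :=
  (Fintype.card (J → ZMod 2) : ℂ)⁻¹ • ∑ t, zmodTwoSign (s ⬝ᵥ t) • U t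

omit [StarModule ℂ A] in
theorem U_mul_proj (h : IsWeylPair W U) (t s : J → ZMod 2) :
    U t * proj U s = zmodTwoSign (s ⬝ᵥ t) • proj U s := by
  rw [proj, mul_smul_comm, smul_comm (zmodTwoSign _)]
  congr 1
  rw [Finset.mul_sum, Finset.smul_sum]
  refine Fintype.sum_equiv (Equiv.addLeft t) _ _ fun r => ?_
  simp only [Equiv.coe_addLeft, mul_smul_comm, ← h.U_add, dotProduct_add, zmodTwoSign_add,
    smul_smul, ← mul_assoc, zmodTwoSign_mul_self, one_mul]

-- Orthogonality of characters: `U t` acts on `proj U s'` by a sign, so the product is `proj U s'`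
-- times the average of the character `s + s'`.
omit [StarModule ℂ A] in
theorem proj_mul_proj (h : IsWeylPair W U) (s s' : J → ZMod 2) :
    proj U s * proj U s' = if s = s' then proj U s' else 0 := by
  rw [proj, smul_mul_assoc, Finset.sum_mul]
  simp only [smul_mul_assoc, h.U_mul_proj, smul_smul, ← zmodTwoSign_add, ← add_dotProduct]
  rw [← Finset.sum_smul, smul_smul]
  simp only [dotProduct_comm (s + s')]
  rw [sum_zmodTwoSign_dotProduct]
  by_cases hs : s = s'
  · rw [if_pos hs, hs, if_pos (ZMod.pi_two_add_self s'), inv_mul_cancel₀, one_smul]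
    exact Nat.cast_ne_zero.2 Fintype.card_ne_zero
  · rw [if_neg hs, if_neg, mul_zero, zero_smul]
    rwa [ZMod.pi_two_add_eq_zero]

omit [StarModule ℂ A] in
theorem sum_proj (h : IsWeylPair W U) : ∑ s, proj U s = 1 := by
  simp only [proj]
  rw [← Finset.smul_sum, Finset.sum_comm]
  simp only [← Finset.sum_smul, sum_zmodTwoSign_dotProduct, ite_smul, zero_smul]
  rw [Finset.sum_ite_eq' Finset.univ, if_pos (Finset.mem_univ _), h.U_zero, smul_smul,
    inv_mul_cancel₀ (Nat.cast_ne_zero.2 Fintype.card_ne_zero), one_smul]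

theorem star_proj (h : IsWeylPair W U) (s : J → ZMod 2) : star (proj U s) = proj U s := by
  simp only [proj, star_smul, star_sum, star_zmodTwoSign, h.star_U]
  simp

-- Moving `W r` past `U t` introduces the sign $(-1)^{r\cdot t}$, which translates the character by
-- `r`. Thus the `W` permute the spectral projections simply transitively and serve as the
-- off-diagonal parts of matrix units.
omit [StarModule ℂ A] in
theorem W_mul_proj (h : IsWeylPair W U) (r s : J → ZMod 2) :
    W r * proj U s = proj U (r + s) * W r := by
  simp only [proj, mul_smul_comm, smul_mul_assoc, Finset.mul_sum, Finset.sum_mul, h.comm,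
    add_dotProduct, zmodTwoSign_add, smul_smul]
  simp only [mul_comm]

omit [StarModule ℂ A] [DecidableEq J] in
theorem W_mul_self (h : IsWeylPair W U) (s : J → ZMod 2) : W s * W s = 1 := by
  rw [← h.W_add, ZMod.pi_two_add_self, h.W_zero]

omit [StarModule ℂ A] in
theorem W_conj_proj (h : IsWeylPair W U) (s : J → ZMod 2) : W s * proj U 0 * W s = proj U s := by
  rw [h.W_mul_proj, add_zero, mul_assoc, h.W_mul_self, mul_one]

/-- The ⋆-homomorphism from a matrix algebra defined by a Weyl pair. -/
noncomputable def matrixHom (h : IsWeylPair W U) :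
    Matrix (J → ZMod 2) (J → ZMod 2) ℂ →⋆ₐ[ℂ] A :=
  .ofMatrixUnits (fun s t => W s * proj U 0 * W t)
    (fun s t s' t' => by
      -- The middle factor `W t * W s' = W (t + s')` carries the second `proj U 0` to `proj U (t +
      -- s')`, which is orthogonal to `proj U 0` unless `t = s'`.
      have h1 : W s * proj U 0 * W t * (W s' * proj U 0 * W t') =
          W s * (proj U 0 * proj U (t + s')) * (W (t + s') * W t') := by
        calc _ = W s * proj U 0 * ((W t * W s') * proj U 0) * W t' := by simp only [mul_assoc]
          _ = _ := by
            rw [← h.W_add, h.W_mul_proj (t + s') 0, add_zero]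
            simp only [mul_assoc]
      rw [h1, h.proj_mul_proj]
      by_cases hts : t = s'
      · subst hts
        rw [ZMod.pi_two_add_self, if_pos rfl, if_pos rfl, h.W_zero, one_mul]
      · rw [if_neg hts, if_neg, mul_zero, zero_mul]
        rw [eq_comm, ZMod.pi_two_add_eq_zero]
        exact hts)
    (by simp only [h.W_conj_proj]; exact h.sum_proj)
    (fun s t => by simp only [star_mul, h.star_W, h.star_proj, mul_assoc])

theorem mem_range_matrixHom (h : IsWeylPair W U) (s t : J → ZMod 2) :
    W s * proj U 0 * W t ∈ h.matrixHom.range :=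
  ⟨Matrix.single s t 1, StarAlgHom.ofMatrixUnits_single ..⟩

/-- Inserting the partition of unity `∑ proj U s = 1` writes `U t` as a signed sum of diagonal
matrix units. -/
theorem U_mem_range (h : IsWeylPair W U) (t : J → ZMod 2) : U t ∈ h.matrixHom.range := by
  rw [← mul_one (U t), ← h.sum_proj, Finset.mul_sum]
  refine sum_mem fun s _ => ?_
  rw [h.U_mul_proj, ← h.W_conj_proj]
  exact SMulMemClass.smul_mem _ (h.mem_range_matrixHom s s)

theorem W_mem_range (h : IsWeylPair W U) (r : J → ZMod 2) : W r ∈ h.matrixHom.range := by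
  rw [← mul_one (W r), ← h.sum_proj, Finset.mul_sum]
  refine sum_mem fun s _ => ?_
  rw [← h.W_conj_proj, ← mul_assoc, ← mul_assoc, ← h.W_add]
  exact h.mem_range_matrixHom _ s

theorem range_matrixHom_le (h : IsWeylPair W U) {B : StarSubalgebra ℂ A} (hW : ∀ s, W s ∈ B)
    (hU : ∀ t, U t ∈ B) : h.matrixHom.range ≤ B := by
  rintro _ ⟨m, rfl⟩
  change h.matrixHom m ∈ B
  rw [matrixHom, StarAlgHom.ofMatrixUnits_apply]
  refine sum_mem fun s _ => sum_mem fun t _ => SMulMemClass.smul_mem _ ?_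
  refine mul_mem (mul_mem (hW s) ?_) (hW t)
  exact SMulMemClass.smul_mem _ (sum_mem fun t _ => SMulMemClass.smul_mem _ (hU t))

end IsWeylPair

end WeylPair

/-! ### Elementary abelian 2-groups of involutions -/

/-- Commuting self-adjoint involutions define a representation of an elementary abelian
`2`-group. -/
theorem exists_finsupp_representation {A : Type*} [Ring A] [StarRing A] {Z : Type*}
    (z : Z → A) (hsq : ∀ x, z x * z x = 1)
    (hstar : ∀ x, star (z x) = z x) (hcomm : ∀ x y, z x * z y = z y * z x) :
    ∃ W : (Z →₀ ZMod 2) → A, W 0 = 1 ∧ (∀ s t, W (s + t) = W s * W t) ∧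
      (∀ s, star (W s) = W s) ∧ ∀ x, W (Finsupp.single x 1) = z x := by
  -- Finitely supported products need a commutative monoid, so they are formed in the submonoid
  -- generated by the involutions and then mapped to `A`.
  have := Submonoid.isMulCommutative_closure A (s := Set.range z) (by
    rintro _ ⟨x, rfl⟩ _ ⟨y, rfl⟩
    exact hcomm x y)
  let : CommMonoid (Submonoid.closure (Set.range z)) :=
    { Submonoid.toMonoid (Submonoid.closure (Set.range z)) with mul_comm := this.is_comm.comm }
  let z' : Z → Submonoid.closure (Set.range z) := fun x => ⟨z x, Submonoid.subset_closure ⟨x, rfl⟩⟩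
  have hz' : ∀ x, z' x * z' x = 1 := fun x => Subtype.ext (hsq x)
  have hadd : ∀ x (a b : ZMod 2), z' x ^ (a + b).val = z' x ^ a.val * z' x ^ b.val := by
    intro x a b
    rw [← pow_add, ZMod.val_add, ← Nat.div_add_mod (a.val + b.val) 2]
    simp [pow_add, pow_mul, pow_two, hz']
  let W : (Z →₀ ZMod 2) → A := fun s => (s.prod fun x k => z' x ^ k.val : _)
  have W_add : ∀ s t, W (s + t) = W s * W t := fun s t =>
    congrArg Subtype.val (Finsupp.prod_add_index' (h := fun x (k : ZMod 2) => z' x ^ k.val)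
      (fun x => by simp) hadd)
  have W_zero : W 0 = 1 := congrArg Subtype.val Finsupp.prod_zero_index
  have W_single : ∀ x, W (Finsupp.single x 1) = z x := fun x => by
    have : (Finsupp.single x (1 : ZMod 2)).prod (fun x k => z' x ^ k.val) = z' x := by
      rw [Finsupp.prod_single_index (by simp)]
      exact pow_one _
    exact congrArg Subtype.val this
  refine ⟨W, W_zero, W_add, fun s => ?_, W_single⟩
  induction s using Finsupp.induction_linear with
  | zero => rw [W_zero, star_one]
  | add s t hs ht => rw [W_add, star_mul, hs, ht, ← W_add, ← W_add, add_comm]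
  | single x k =>
    rcases ZMod.two_eq_zero_or_one k with rfl | rfl
    · simp [W_zero]
    · exact (congrArg star (W_single x)).trans ((hstar x).trans (W_single x).symm)

/-- Commutation up to sign with a representation may be checked on generators. -/
theorem mul_eq_zmodTwoSign_smul_of_single {A : Type*} [Ring A] [Algebra ℂ A] {Z : Type*}
    {W : (Z →₀ ZMod 2) → A} (h0 : W 0 = 1)
    (hadd : ∀ s t, W (s + t) = W s * W t) (a : A) (l : (Z →₀ ZMod 2) → ZMod 2)
    (hl : ∀ s t, l (s + t) = l s + l t) (h : ∀ x, a * W (Finsupp.single x 1) =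
      zmodTwoSign (l (Finsupp.single x 1)) • (W (Finsupp.single x 1) * a)) (s : Z →₀ ZMod 2) :
    a * W s = zmodTwoSign (l s) • (W s * a) := by
  have hl0 : l 0 = 0 := by simpa using hl 0 0
  induction s using Finsupp.induction_linear with
  | zero => simp [h0, hl0]
  | add s t hs ht =>
    rw [hadd, ← mul_assoc, hs, smul_mul_assoc, mul_assoc, ht, mul_smul_comm, smul_smul, hl,
      zmodTwoSign_add, mul_assoc]
  | single x k =>
    rcases ZMod.two_eq_zero_or_one k with rfl | rfl
    · simp [h0, hl0]
    · exact h x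

theorem mem_of_single_mem {A : Type*} [Monoid A] {Z S : Type*} [SetLike S A] [SubmonoidClass S A] {B : S}
    {W : (Z →₀ ZMod 2) → A} (h0 : W 0 = 1) (hadd : ∀ s t, W (s + t) = W s * W t)
    (s : Z →₀ ZMod 2) (h : ∀ x ∈ s.support, W (Finsupp.single x 1) ∈ B) : W s ∈ B := by
  induction s using Finsupp.induction with
  | zero => rw [h0]; exact one_mem B
  | single_add x k s hx hk ih =>
    obtain rfl := (ZMod.two_eq_zero_or_one k).resolve_left hk
    rw [hadd]
    classical
    have hsupp := Finsupp.support_single_add hx hk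
    refine mul_mem (h x (by simp [hsupp])) (ih fun y hy => h y ?_)
    rw [hsupp]
    exact Finset.mem_cons_of_mem hy

/-! ### A representation of `B(G)` -/

section Representation

/-- The Hilbert space `ℓ²(ι)`. -/
abbrev EllTwo (ι : Type*) : Type _ := lp (fun _ : ι => ℂ) 2

variable {ι : Type*} [AddCommGroup ι]

open Classical in
theorem EllTwo.ext_single {ι : Type*} {S T : EllTwo ι →L[ℂ] EllTwo ι}
    (h : ∀ i, S (lp.single 2 i 1) = T (lp.single 2 i 1)) : S = T := by
  ext1 f
  have hf := lp.hasSum_single (p := 2) (by simp) f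
  refine (hf.mapL S).unique ?_
  convert hf.mapL T using 2 with i
  have : lp.single 2 i (f i) = f i • lp.single (E := fun _ : ι => ℂ) 2 i (1 : ℂ) := by
    rw [← lp.single_smul, smul_eq_mul, mul_one]
  rw [this, map_smul, map_smul, h]

open Classical in
theorem EllTwo.orthonormal_signed_shift (l : ι →+ ZMod 2) (d : ι) : Orthonormal ℂ
    fun s => zmodTwoSign (l s) • (lp.single 2 (s + d) 1 : EllTwo ι) := by
  refine ⟨fun s => ?_, fun s t hst => ?_⟩
  · rw [norm_smul, norm_zmodTwoSign, lp.norm_single (by simp), norm_one, one_mul]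
  · change inner ℂ _ _ = _
    rw [inner_smul_left, inner_smul_right, lp.inner_single_left, lp.single_apply_ne, inner_zero_right,
      mul_zero, mul_zero]
    simpa using hst

open Classical in
/-- The isometry `e_s ↦ (-1) ^ l(s) • e_{s + d}` of `ℓ²(ι)`. -/
noncomputable def signedShift (l : ι →+ ZMod 2) (d : ι) : EllTwo ι →L[ℂ] EllTwo ι :=
  (EllTwo.orthonormal_signed_shift l d).orthogonalFamily.linearIsometry.toContinuousLinearMap

open Classical in
theorem signedShift_single (l : ι →+ ZMod 2) (d s : ι) :
    signedShift l d (lp.single 2 s 1) = zmodTwoSign (l s) • lp.single 2 (s + d) 1 := by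
  refine ((EllTwo.orthonormal_signed_shift l
    d).orthogonalFamily.linearIsometry_apply_single (1 : ℂ)).trans ?_
  simp

/-- Both products send $e_s$ to $\pm e_{s+d+d'}$, and the quotient of the signs does not depend on
`s`. -/
theorem signedShift_mul (l l' : ι →+ ZMod 2) (d d' : ι) :
    signedShift l d * signedShift l' d' =
      zmodTwoSign (l d' + l' d) • (signedShift l' d' * signedShift l d) := by
  refine EllTwo.ext_single fun s => ?_
  simp only [mul_apply_eq_comp, smul_apply, signedShift_single,
    map_smul, smul_smul, ← zmodTwoSign_add, map_add]
  rw [add_right_comm s d d']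
  congr 2
  have h : l' d + l' d = 0 := CharTwo.add_self_eq_zero _
  linear_combination -h

theorem signedShift_mul_self (h2 : ∀ s : ι, s + s = 0) {l : ι →+ ZMod 2} {d : ι} (h : l d = 0) :
    signedShift l d * signedShift l d = 1 := by
  refine EllTwo.ext_single fun s => ?_
  simp only [mul_apply_eq_comp, signedShift_single, map_smul, smul_smul, map_add, h,
    add_zero, zmodTwoSign_mul_self, one_smul, one_apply_eq_self]
  rw [add_assoc, h2, add_zero]

/-- An isometry whose square is 1 is surjective, hence unitary. -/
theorem signedShift_mul_star (h2 : ∀ s : ι, s + s = 0) {l : ι →+ ZMod 2} {d : ι} (h : l d = 0) :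
    signedShift l d * star (signedShift l d) = 1 := by
  have h1 : star (signedShift l d) * signedShift l d = 1 :=
    LinearIsometry.adjoint_comp_self _
  calc signedShift l d * star (signedShift l d)
      = star (signedShift l d) * signedShift l d * (signedShift l d * star (signedShift l d)) := by
        rw [h1, one_mul]
    _ = star (signedShift l d) * (signedShift l d * signedShift l d) * star (signedShift l d) := by
        simp only [mul_assoc]
    _ = star (signedShift l d * signedShift l d) := by
        rw [signedShift_mul_self h2 h, mul_one, ← star_mul, signedShift_mul_self h2 h]
    _ = 1 := by rw [signedShift_mul_self h2 h, star_one]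

theorem SimpleGraph.isRepresentation_signedShift {V : Type*} (G : SimpleGraph V)
    (h2 : ∀ s : ι, s + s = 0) (l : V → ι →+ ZMod 2) (d : V → ι) (hd : ∀ x, l x (d x) = 0)
    (hadj : ∀ x y, G.Adj x y → l x (d y) + l y (d x) = 1)
    (hnadj : ∀ x y, ¬ G.Adj x y → l x (d y) + l y (d x) = 0) :
    G.IsRepresentation fun x => signedShift (l x) (d x) where
  mul_star x := signedShift_mul_star h2 (hd x)
  sq x := by rw [pow_two, signedShift_mul_self h2 (hd x)]
  comm x y h := by rw [signedShift_mul, hnadj x y h, zmodTwoSign_zero, one_smul]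
  anticomm x y h := by rw [signedShift_mul, hadj x y h, zmodTwoSign_one, neg_one_smul]

end Representation

/-! ### The membership graph and nontriviality of its algebra -/

theorem membershipGraph_adj_inl_inr {Y : Type*} {𝔸 : Set (Set Y)} {i : Y} {x : 𝔸} :
    (membershipGraph 𝔸).Adj (.inl i) (.inr x) ↔ i ∈ x.1 := by
  simp [membershipGraph]

theorem membershipGraph_adj_inr_inl {Y : Type*} {𝔸 : Set (Set Y)} {i : Y} {x : 𝔸} :
    (membershipGraph 𝔸).Adj (.inr x) (.inl i) ↔ i ∈ x.1 := by
  rw [SimpleGraph.adj_comm, membershipGraph_adj_inl_inr]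

theorem membershipGraph_not_adj_inl {Y : Type*} {𝔸 : Set (Set Y)} {i j : Y} :
    ¬ (membershipGraph 𝔸).Adj (.inl i) (.inl j) := by
  simp [membershipGraph]

theorem membershipGraph_not_adj_inr {Y : Type*} {𝔸 : Set (Set Y)} {x y : 𝔸} :
    ¬ (membershipGraph 𝔸).Adj (.inr x) (.inr y) := by
  simp [membershipGraph]

instance membershipGraph.nontrivial_B {Y : Type*} (𝔸 : Set (Set Y)) :
    Nontrivial (membershipGraph 𝔸).B := by
  classical
  let ev : Y → (𝔸 →₀ ZMod 2) →ₗ[ZMod 2] ZMod 2 := fun i =>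
    Finsupp.linearCombination (ZMod 2) fun x : 𝔸 => if i ∈ x.1 then 1 else 0
  have ev_single : ∀ i x, ev i (Finsupp.single x 1) = if i ∈ x.1 then 1 else 0 := fun i x => by
    simp [ev]
  -- On $\ell^2$ of the finitely supported vectors on `𝔸`, a point `i` acts by the diagonal signs
  -- $(-1)^{\mathrm{ev}_i}$ and a set `x` by translation by its basis vector.
  have hrep := (membershipGraph 𝔸).isRepresentation_signedShift (ι := 𝔸 →₀ ZMod 2)
    (fun s => Finsupp.ext fun _ => CharTwo.add_self_eq_zero _)
    (Sum.elim (fun i => (ev i).toAddMonoidHom) fun _ => 0)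
    (Sum.elim (fun _ => 0) fun x => Finsupp.single x 1)
    (by rintro (i | x) <;> simp)
    (by
      rintro (i | x) (j | y) h
      · exact absurd h membershipGraph_not_adj_inl
      · simp [ev_single, membershipGraph_adj_inl_inr.1 h]
      · simp [ev_single, membershipGraph_adj_inr_inl.1 h]
      · exact absurd h membershipGraph_not_adj_inr)
    (by
      rintro (i | x) (j | y) h
      · simp
      · simp [ev_single, mt membershipGraph_adj_inl_inr.2 h]
      · simp [ev_single, mt membershipGraph_adj_inr_inl.2 h]
      · simp)
  obtain ⟨π, -, -⟩ := SimpleGraph.B.existsUnique_lift _ hrep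
  have : Nontrivial (EllTwo (𝔸 →₀ ZMod 2)) := by
    refine ⟨⟨lp.single 2 0 1, 0, fun h => ?_⟩⟩
    have := congrArg norm h
    rw [lp.norm_single (by simp), norm_one, norm_zero] at this
    exact one_ne_zero this
  exact π.toAlgHom.toRingHom.domain_nontrivial

/-! ### Matrix subalgebras of `B(G)` -/

namespace SimpleGraph.B

variable {V : Type*} (G : SimpleGraph V)

theorem u_mul_self (x : V) : u G x * u G x = 1 := by
  rw [← pow_two, (isRepresentation_u G).sq]

theorem star_u (x : V) : star (u G x) = u G x := by
  rw [← one_mul (star _), ← u_mul_self G x, mul_assoc, (isRepresentation_u G).mul_star, mul_one]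

/-- The ⋆-subalgebra generated by finitely many generators of `B(G)`. -/
noncomputable def finiteSubalgebra (F : Finset V) : StarSubalgebra ℂ G.B :=
  StarAlgebra.adjoin ℂ (u G '' F)

variable {G}

theorem u_mem_finiteSubalgebra {F : Finset V} {x : V} (hx : x ∈ F) :
    u G x ∈ finiteSubalgebra G F :=
  StarAlgebra.subset_adjoin ℂ _ ⟨x, hx, rfl⟩

theorem finiteSubalgebra_mono {F F' : Finset V} (h : F ⊆ F') :
    finiteSubalgebra G F ≤ finiteSubalgebra G F' :=
  StarAlgebra.adjoin_mono (Set.image_mono h)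

theorem finiteSubalgebra_le {F : Finset V} {D : StarSubalgebra ℂ G.B} (h : ∀ x ∈ F, u G x ∈ D) :
    finiteSubalgebra G F ≤ D :=
  StarAlgebra.adjoin_le (by rintro _ ⟨x, hx, rfl⟩; exact h x hx)

open Classical in
theorem exists_coe_mem_finiteSubalgebra (a : G.PreB) : ∃ F, coe G a ∈ finiteSubalgebra G F := by
  induction a using WordAlgebra.induction with
  | h0 =>
    have h : coe G (0 : WordAlgebra V) = 0 := UniformSpace.Completion.coe_zero (α := G.PreB)
    exact ⟨∅, by rw [h]; exact zero_mem _⟩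
  | hadd a b ha hb =>
    obtain ⟨F, hF⟩ := ha
    obtain ⟨F', hF'⟩ := hb
    refine ⟨F ∪ F', ?_⟩
    have h := coe_add (G := G) a b
    exact h ▸ add_mem (finiteSubalgebra_mono Finset.subset_union_left hF)
      (finiteSubalgebra_mono Finset.subset_union_right hF')
  | hmono w c =>
    have h1 : ∃ F, coe G (WordAlgebra.mono w 1 : WordAlgebra V) ∈ finiteSubalgebra G F := by
      induction w using FreeMonoid.inductionOn' with
      | one => exact ⟨∅, (coe_one (G := G)) ▸ one_mem _⟩
      | of_mul x w ih =>
        obtain ⟨F, hF⟩ := ih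
        have h : (WordAlgebra.mono (FreeMonoid.of x * w) 1 : WordAlgebra V) =
            WordAlgebra.gen x * WordAlgebra.mono w 1 := by
          rw [WordAlgebra.gen, WordAlgebra.mono_mul, mul_one]
        have h' : coe G (WordAlgebra.gen x * WordAlgebra.mono w 1 : WordAlgebra V) =
            u G x * coe G (WordAlgebra.mono w 1 : WordAlgebra V) := coe_mul _ _
        refine ⟨insert x F, ?_⟩
        rw [h, h']
        exact mul_mem (u_mem_finiteSubalgebra (Finset.mem_insert_self x F))
          (finiteSubalgebra_mono (Finset.subset_insert x F) hF)
    obtain ⟨F, hF⟩ := h1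
    have h : (WordAlgebra.mono w c : WordAlgebra V) = c • WordAlgebra.mono w 1 := by
      rw [WordAlgebra.smul_mono, mul_one]
    have h' : coe G (c • WordAlgebra.mono w 1 : WordAlgebra V) =
        c • coe G (WordAlgebra.mono w 1 : WordAlgebra V) := coe_smul _ _
    exact ⟨F, by rw [h, h']; exact SMulMemClass.smul_mem c hF⟩

/-- `B(G)` is AM as soon as every finite set of generators is contained in a full matrix algebra
generated by generators. -/
theorem isAM_of_exists_matrix (h : ∀ F : Finset V, ∃ (D : StarSubalgebra ℂ G.B) (n : ℕ)
    (F' : Finset V), 0 < n ∧ Nonempty (D ≃⋆ₐ[ℂ] Matrix (Fin n) (Fin n) ℂ) ∧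
      finiteSubalgebra G F ≤ D ∧ D ≤ finiteSubalgebra G F') : IsAM G.B := by
  classical
  -- The bound by a `finiteSubalgebra` is what makes this family directed: two members lie in the
  -- algebra of the union of their finite sets, hence in a further member.
  refine ⟨{D | (∃ n : ℕ, 0 < n ∧ Nonempty (D ≃⋆ₐ[ℂ] Matrix (Fin n) (Fin n) ℂ)) ∧
    ∃ F, D ≤ finiteSubalgebra G F}, ?_, ?_, fun D hD => hD.1, ?_⟩
  · obtain ⟨D, n, F', hn, he, -, hF'⟩ := h ∅
    exact ⟨D, ⟨n, hn, he⟩, F', hF'⟩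
  · rintro D ⟨-, F, hF⟩ D' ⟨-, F', hF'⟩
    obtain ⟨E, n, F'', hn, he, hE, hF''⟩ := h (F ∪ F')
    exact ⟨E, ⟨⟨n, hn, he⟩, F'', hF''⟩,
      (hF.trans (finiteSubalgebra_mono Finset.subset_union_left)).trans hE,
      (hF'.trans (finiteSubalgebra_mono Finset.subset_union_right)).trans hE⟩
  · have hd : DenseRange (coe G) := UniformSpace.Completion.denseRange_coe
    refine hd.mono ?_
    rintro _ ⟨a, rfl⟩
    obtain ⟨F, hF⟩ := exists_coe_mem_finiteSubalgebra a
    obtain ⟨D, n, F', hn, he, hD, hF'⟩ := h F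
    exact Set.mem_iUnion₂.2 ⟨D, ⟨⟨n, hn, he⟩, F', hF'⟩, hD hF⟩

end SimpleGraph.B

/-- A ⋆-homomorphism from a matrix algebra to a nontrivial ⋆-algebra has range isomorphic to that
matrix algebra. -/
theorem StarAlgHom.nonempty_range_equiv_matrix {A : Type*} [Ring A] [StarRing A] [Algebra ℂ A]
    [StarModule ℂ A] [Nontrivial A] {ι : Type*} [Fintype ι] [DecidableEq ι] [Nonempty ι]
    (Φ : Matrix ι ι ℂ →⋆ₐ[ℂ] A) :
    Nonempty (Φ.range ≃⋆ₐ[ℂ] Matrix (Fin (Fintype.card ι)) (Fin (Fintype.card ι)) ℂ) := by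
  have hinj : Function.Injective Φ := (Φ : Matrix ι ι ℂ →+* A).injective
  let e := Matrix.reindexAlgEquiv ℂ ℂ (Fintype.equivFin ι)
  let e' : Matrix ι ι ℂ ≃⋆ₐ[ℂ] Matrix (Fin (Fintype.card ι)) (Fin (Fintype.card ι)) ℂ :=
    { e with
      map_star' := fun a => rfl
      map_smul' := fun c a => map_smul e c a }
  exact ⟨(StarAlgEquiv.ofInjective Φ hinj).symm.trans e'⟩

/-- A surjective linear map has a linear section that is prescribed on the image of a subspace on
which the map is injective. -/
theorem LinearMap.exists_section_extending {K M N : Type*} [Field K] [AddCommGroup M] [Module K M]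
    [AddCommGroup N] [Module K N] (v : M →ₗ[K] N) (hv : Function.Surjective v) (P : Submodule K M)
    (hP : Function.Injective (v ∘ₗ P.subtype)) :
    ∃ c : N →ₗ[K] M, (∀ y, v (c y) = y) ∧ ∀ x ∈ P, c (v x) = x := by
  obtain ⟨c₀, hc₀⟩ := v.exists_rightInverse_of_surjective (LinearMap.range_eq_top.2 hv)
  obtain ⟨l, hl⟩ := (v ∘ₗ P.subtype).exists_leftInverse_of_injective (LinearMap.ker_eq_bot.2 hP)
  have h1 : ∀ y, v (c₀ y) = y := fun y => LinearMap.congr_fun hc₀ y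
  have h2 : ∀ p : P, l (v p) = p := fun p => LinearMap.congr_fun hl p
  -- The correction $l-c_0vl$ of the section $c_0$ takes values in the kernel of `v`; at `v x` with
  -- `x ∈ P` one has $l(v x)=x$, and the two terms with $c_0$ cancel.
  refine ⟨c₀ + P.subtype ∘ₗ l - c₀ ∘ₗ v ∘ₗ P.subtype ∘ₗ l, fun y => by simp [h1], fun x hx => ?_⟩
  have h3 := h2 ⟨x, hx⟩
  simp only at h3
  simp [h3]

/-! ### Incidence over ℤ/2 and the AM property -/

section MembershipGraph

variable {Y : Type u} {𝔸 : Set (Set Y)}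

theorem IsDenseFamily.exists_mem_iff (h : IsDenseFamily 𝔸) (F : Finset Y) (s : Set Y) :
    ∃ x ∈ 𝔸, ∀ i ∈ F, (i ∈ x ↔ i ∈ s) := by
  classical
  have hopen : IsOpen ((F : Set Y).pi fun i => ({decide (i ∈ s)} : Set Bool)) :=
    isOpen_set_pi F.finite_toSet fun _ _ => isOpen_discrete _
  obtain ⟨_, hf, x, hx, rfl⟩ := h.inter_open_nonempty _ hopen ⟨fun i => decide (i ∈ s), by simp⟩
  refine ⟨x, hx, fun i hi => ?_⟩
  simpa using hf i hi

theorem IsIndependentFamily.exists_separating (h : IsIndependentFamily 𝔸) (F : Finset 𝔸) (x : 𝔸) :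
    ∃ i : Y, i ∈ x.1 ∧ ∀ y ∈ F, y ≠ x → i ∉ y.1 := by
  classical
  obtain ⟨i, hi, hi'⟩ := h {x.1} (Subtype.val '' (F.erase x : Set 𝔸)) (by simp)
    (by rintro _ ⟨y, -, rfl⟩; exact y.2) (Set.finite_singleton _)
    ((F.erase x).finite_toSet.image _)
    (by
      rw [Set.disjoint_singleton_left]
      rintro ⟨y, hy, hyx⟩
      exact Finset.ne_of_mem_erase hy (Subtype.ext hyx)) (Set.singleton_nonempty _)
  refine ⟨i, by simpa using hi, fun y hy hyx hiy => hi' ⟨y.1, ⟨y, ?_, rfl⟩, hiy⟩⟩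
  exact Finset.mem_erase.2 ⟨hyx, hy⟩

open Classical in
/-- The incidence map over `ℤ/2`, restricted to finitely many points. -/
noncomputable def incidenceMap (𝔸 : Set (Set Y)) (F : Finset Y) :
    (𝔸 →₀ ZMod 2) →ₗ[ZMod 2] (F → ZMod 2) :=
  Finsupp.linearCombination (ZMod 2) fun x i => if i.1 ∈ x.1 then 1 else 0

open Classical in
theorem incidenceMap_single (F : Finset Y) (x : 𝔸) (i : F) :
    incidenceMap 𝔸 F (Finsupp.single x 1) i = if i.1 ∈ x.1 then 1 else 0 := by
  simp [incidenceMap]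

/-- Density provides a member of `𝔸` that meets `F` in exactly one prescribed point, so every basis
vector is attained. -/
theorem IsDenseFamily.incidenceMap_surjective (h : IsDenseFamily 𝔸) (F : Finset Y) :
    Function.Surjective (incidenceMap 𝔸 F) := by
  classical
  rw [← LinearMap.range_eq_top, eq_top_iff, ← (Pi.basisFun (ZMod 2) F).span_eq, Submodule.span_le]
  rintro _ ⟨i, rfl⟩
  obtain ⟨x, hx, hxi⟩ := h.exists_mem_iff F {i.1}
  refine ⟨Finsupp.single ⟨x, hx⟩ 1, ?_⟩
  ext j
  rw [incidenceMap_single, Pi.basisFun_apply, Pi.single_apply]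
  simp only [hxi j.1 j.2, Set.mem_singleton_iff, Subtype.ext_iff]

/-- The coordinate at `p x` reads off the coefficient at `x`, since among the members of `A` only
`x` contains `p x`. -/
theorem incidenceMap_injective_supported (A : Finset 𝔸) (F : Finset Y) (p : 𝔸 → Y)
    (hp : ∀ x ∈ A, p x ∈ x.1 ∧ ∀ y ∈ A, y ≠ x → p x ∉ y.1) (hF : ∀ x ∈ A, p x ∈ F) :
    Function.Injective
      (incidenceMap 𝔸 F ∘ₗ (Finsupp.supported (ZMod 2) (ZMod 2) (A : Set 𝔸)).subtype) := by
  classical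
  refine (injective_iff_map_eq_zero _).2 ?_
  rintro ⟨s, hs⟩ h
  rw [Finsupp.mem_supported] at hs
  refine Subtype.ext (Finsupp.ext fun x => ?_)
  by_cases hx : x ∈ A
  · have h1 : incidenceMap 𝔸 F s ⟨p x, hF x hx⟩ = 0 := congrFun h _
    rw [incidenceMap, Finsupp.linearCombination_apply, Finsupp.sum, Finset.sum_apply,
      Finset.sum_eq_single x] at h1
    · simpa [(hp x hx).1] using h1
    · intro y hy hyx
      simp [(hp x hx).2 y (hs hy) hyx]
    · intro hx
      simp [Finsupp.notMem_support_iff.1 hx]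
  · exact Finsupp.notMem_support_iff.1 fun h => hx (hs h)

theorem IsDenseFamily.exists_incidenceMap_section (h : IsDenseFamily 𝔸) (A : Finset 𝔸)
    (F : Finset Y) (p : 𝔸 → Y) (hp : ∀ x ∈ A, p x ∈ x.1 ∧ ∀ y ∈ A, y ≠ x → p x ∉ y.1)
    (hF : ∀ x ∈ A, p x ∈ F) :
    ∃ c : (F → ZMod 2) →ₗ[ZMod 2] (𝔸 →₀ ZMod 2), (∀ y, incidenceMap 𝔸 F (c y) = y) ∧
      ∀ x ∈ A, c (incidenceMap 𝔸 F (Finsupp.single x 1)) = Finsupp.single x 1 := by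
  obtain ⟨c, hvc, hcv⟩ := (incidenceMap 𝔸 F).exists_section_extending (h.incidenceMap_surjective F) _
    (incidenceMap_injective_supported A F p hp hF)
  exact ⟨c, hvc, fun x hx =>
    hcv _ (Finsupp.single_mem_supported _ _ (Finset.mem_coe.2 hx))⟩

open SimpleGraph.B in
theorem membershipGraph.isAM_B (hindep : IsIndependentFamily 𝔸) (hdense : IsDenseFamily 𝔸) :
    IsAM (membershipGraph 𝔸).B := by
  classical
  refine isAM_of_exists_matrix fun F => ?_
  have hrep := isRepresentation_u (membershipGraph 𝔸)
  set w := u (membershipGraph 𝔸)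
  let A₀ : Finset 𝔸 := F.toRight
  choose p hp using hindep.exists_separating A₀
  -- The separating points are added so that the incidence map is injective on vectors supported in
  -- `A₀`.
  let Y₁ : Finset Y := F.toLeft ∪ A₀.image p
  let v := incidenceMap 𝔸 Y₁
  obtain ⟨c, hvc, hcv⟩ := hdense.exists_incidenceMap_section A₀ Y₁ p (fun x _ => hp x)
    fun x hx => Finset.mem_union_right _ (Finset.mem_image_of_mem p hx)
  obtain ⟨W, W_zero, W_add, star_W, W_single⟩ := exists_finsupp_representation
    (fun x : 𝔸 => w (.inr x)) (fun x => u_mul_self _ _) (fun x => star_u _ _)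
    (fun x y => hrep.comm _ _ membershipGraph_not_adj_inr)
  obtain ⟨U, U_zero, U_add, star_U, U_single⟩ := exists_finsupp_representation
    (fun i : Y₁ => w (.inl i)) (fun x => u_mul_self _ _) (fun x => star_u _ _)
    (fun x y => hrep.comm _ _ membershipGraph_not_adj_inl)
  have hcomm : ∀ (i : Y₁) (x : 𝔸), w (.inl i) * w (.inr x) =
      zmodTwoSign (v (Finsupp.single x 1) i) • (w (.inr x) * w (.inl i)) := fun i x => by
    rw [incidenceMap_single]
    split_ifs with h
    · rw [hrep.anticomm _ _ (membershipGraph_adj_inl_inr.2 h), zmodTwoSign_one, neg_one_smul]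
    · rw [hrep.comm _ _ (mt membershipGraph_adj_inl_inr.1 h), zmodTwoSign_zero, one_smul]
  have hcomm₁ : ∀ (i : Y₁) s, w (.inl i) * W s = zmodTwoSign (v s i) • (W s * w (.inl i)) :=
    fun i s => mul_eq_zmodTwoSign_smul_of_single W_zero W_add _ (fun s => v s i)
      (fun s t => by rw [map_add, Pi.add_apply]) (fun x => by rw [W_single]; exact hcomm i x) s
  have hcomm₂ : ∀ s t, W s * U t = zmodTwoSign (v s ⬝ᵥ t) • (U t * W s) := fun s t =>
    mul_eq_zmodTwoSign_smul_of_single U_zero U_add _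
      (fun t => v s ⬝ᵥ t) (fun t t' => by rw [Finsupp.coe_add, dotProduct_add]) (fun i => by
        rw [U_single, hcomm₁, smul_smul, Finsupp.single_eq_pi_single, dotProduct_single, mul_one,
          zmodTwoSign_mul_self, one_smul]) t
  let ε := (Finsupp.linearEquivFunOnFinite (ZMod 2) (ZMod 2) Y₁).symm
  -- Since `v (c s) = s`, the sign of the commutation becomes the perfect pairing `s ⬝ᵥ t`.
  have hW : IsWeylPair (fun s => W (c s)) (fun t => U (ε t)) :=
    { W_zero := by rw [map_zero, W_zero]
      W_add := fun s t => by rw [map_add, W_add]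
      star_W := fun s => star_W _
      U_zero := by rw [map_zero, U_zero]
      U_add := fun s t => by rw [map_add, U_add]
      star_U := fun s => star_U _
      comm := fun s t => by
        rw [hcomm₂, hvc]
        rfl }
  refine ⟨hW.matrixHom.range, _, Y₁.disjSum (Finset.univ.biUnion fun s => (c s).support),
    Fintype.card_pos, hW.matrixHom.nonempty_range_equiv_matrix, finiteSubalgebra_le ?_,
    hW.range_matrixHom_le (fun s => ?_) (fun t => ?_)⟩
  · rintro (i | x) h
    · have hi : i ∈ Y₁ := Finset.mem_union_left _ (Finset.mem_toLeft.2 h)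
      have := hW.U_mem_range (ε.symm (Finsupp.single ⟨i, hi⟩ 1))
      rwa [LinearEquiv.apply_symm_apply, U_single] at this
    -- This is where the prescribed values of the section are needed: `c` returns `v x` to `x`, so
    -- the generator at `x` itself is one of the `W (c s)`.
    · have := hW.W_mem_range (v (Finsupp.single x 1))
      rwa [hcv x (Finset.mem_toRight.2 h), W_single] at this
  · refine mem_of_single_mem W_zero W_add _ fun x hx => ?_
    rw [W_single]
    exact u_mem_finiteSubalgebra (Finset.inr_mem_disjSum.2
      (Finset.mem_biUnion.2 ⟨s, Finset.mem_univ s, hx⟩))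
  · refine mem_of_single_mem U_zero U_add _ fun i hi => ?_
    rw [U_single]
    exact u_mem_finiteSubalgebra (Finset.inl_mem_disjSum.2 i.2)

end MembershipGraph

theorem mainTheorem7 (Y : Type u) (𝔸 : Set (Set Y))
    (hinf : 𝔸.Infinite) (hindep : IsIndependentFamily 𝔸) (hdense : IsDenseFamily 𝔸) :
    IsAM (membershipGraph 𝔸).B ∧
      IsSimpleCStar (membershipGraph 𝔸).B ∧
      IsNuclear.{u, v} (membershipGraph 𝔸).B ∧
      IsUnital (membershipGraph 𝔸).B ∧
      HasUniqueTrace (membershipGraph 𝔸).B := by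
  have hAM := membershipGraph.isAM_B hindep hdense
  exact ⟨hAM, hAM.isSimpleCStar, hAM.isNuclear, ⟨1, fun a => ⟨one_mul a, mul_one a⟩⟩,
    hAM.hasUniqueTrace⟩
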